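/- Let $f_1,\dots,f_m:\mathbb R^n\to\mathbb R$ be convex and differentiable with $\|\nabla f_i(x)-\nabla f_i(y)\|_2\le L_i\|x-y\|_2$ for all $x,y$, where $L_i\ge 0$ and $L:=\sum_{i=1}^m L_i>0$. Let $f:=\sum_{i=1}^m f_i$, assume that the set $X^*$ of minimizers of $f$ is nonempty, and let $f^*:=\min f$. For $x^0\in\mathbb R^n$ the relative accuracy of $\bar x\in\mathbb R^n$ is $$R_{ac}(\bar x):=\frac{2[f(\bar x)-f^*]}{L\,(1+\min_{u\in X^*}\|x^0-u\|_2^2)} .$$ Let $\epsilon>0$, $\delta:=L\epsilon/2$, and let $C:=8L/\delta$ or $C:=8(L+\delta)/\delta$. The randomized primal-dual gradient (RPDG) method, applied to the perturbed problem $\min_{x\in\mathbb R^n}\{f(x)+\tfrac{\delta}{2}\|x-x^0\|_2^2\}$, is the following. Put $S:=\sqrt{(m-1)^2+4mC}$, $$p_i:=\frac1{2m}+\frac{L_i}{2L},\quad \tau:=\frac{S-(m-1)}{2m},\quad \eta:=\frac{\delta\,(S+m-1)}{2},\quad \alpha:=1-\frac{1}{(m+1)+S},$$ $x^{-1}:=x^0$,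 $\underline x_i^0:=x^0$, $y_i^0:=\nabla f_i(x^0)$, $g^0:=\sum_i y_i^0$. The indices $i_1,i_2,\dots$ are independent with $\mathrm{Prob}\{i_t=i\}=p_i$. In iteration $t\ge1$, with $j:=i_t$, $$\tilde x^t:=\alpha(x^{t-1}-x^{t-2})+x^{t-1},\qquad \underline x_j^t:=\frac{\tilde x^t+\tau\,\underline x_j^{t-1}}{1+\tau},\qquad y_j^t:=\nabla f_j(\underline x_j^t),$$ $\underline x_i^t:=\underline x_i^{t-1}$ and $y_i^t:=y_i^{t-1}$ for $i\ne j$, $$x^t:=\arg\min_{x\in\mathbb R^n}\Big\{\big\langle g^{t-1}+p_j^{-1}(y_j^t-y_j^{t-1}),x\big\rangle+\tfrac{\delta}{2}\|x-x^0\|_2^2+\tfrac{\eta}{2}\|x-x^{t-1}\|_2^2\Big\},\qquad g^t:=g^{t-1}+y_j^t-y_j^{t-1}.$$ The output after $k\ge 1$ iterations is $\bar x^k:=\big(\sum_{t=1}^k\alpha^{-t}\big)^{-1}\sum_{t=1}^k\alpha^{-t}x^t$. There is a universal constant $c>0$ (independent of $n$, $m$, the $f_i$, the $L_i$, $x^0$,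 $\epsilon$ and $\lambda$) such that: 1. If $m\epsilon\le 1$ and $\epsilon\le\frac12$, then $\mathbb E[R_{ac}(\bar x^k)]\le\epsilon$ for every $k\ge c\sqrt{m/\epsilon}\,\log\frac m\epsilon$; that is, expected relative accuracy $\epsilon$ is reached in ${\cal O}\{\sqrt{m/\epsilon}\,\log\frac m\epsilon\}$ iterations. Moreover, for every $\lambda\in(0,1)$, $\mathrm{Prob}\{R_{ac}(\bar x^k)>\epsilon\}\le\lambda$ for every $k\ge c\sqrt{m/\epsilon}\,\log\frac{m}{\lambda\epsilon}$. 2. For all $m\ge1$ and $\epsilon>0$, $\mathbb E[R_{ac}(\bar x^k)]\le\epsilon$ for every $k\ge c\,(m+\sqrt{m/\epsilon})\log\big(m(2+\frac1\epsilon)\big)$, and, for every $\lambda\in(0,1)$, $\mathrm{Prob}\{R_{ac}(\bar x^k)>\epsilon\}\le\lambda$ for every $k\ge c\,(m+\sqrt{m/\epsilon})\log\big(\frac{m}{\lambda}(2+\frac1\epsilon)\big)$. -/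

import Mathlib

open MeasureTheory ProbabilityTheory

noncomputable section

/-- Euclidean space `ℝⁿ` with its standard inner product and norm. -/
abbrev Eucl (n : ℕ) : Type := EuclideanSpace ℝ (Fin n)

/-- The data of a composite problem
`min_{x ∈ X} ∑ i, f i x + h x + μ * ω x`, where `ω` is a differentiable function. -/
structure CompositeProblem (n m : ℕ) where
  f : Fin m → Eucl n → ℝ
  X : Set (Eucl n)
  h : Eucl n → ℝ
  ω : Eucl n → ℝ
  μ : ℝ

namespace CompositeProblem

variable {n m : ℕ}

/-- The objective function `∑ i, f i + h + μ ω`. -/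
def objective (P : CompositeProblem n m) (x : Eucl n) : ℝ :=
  ∑ i, P.f i x + P.h x + P.μ * P.ω x

/-- The primal prox-function (Bregman distance of `ω`)
`P(u, x) = ω(x) - [ω(u) + ⟨∇ω(u), x - u⟩]`. -/
def proxFun (P : CompositeProblem n m) (u x : Eucl n) : ℝ :=
  P.ω x - (P.ω u + inner ℝ (gradient P.ω u) (x - u))

/-- The primal prox-mapping: the minimizer over `X` of
`⟨g, x⟩ + h(x) + μ ω(x) + η P(u, x)`. -/
def proxMap (P : CompositeProblem n m) (g u : Eucl n) (η : ℝ) : Eucl n :=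
  Classical.epsilon fun x => x ∈ P.X ∧
    IsMinOn (fun x => inner ℝ g x + P.h x + P.μ * P.ω x + η * P.proxFun u x) P.X x

end CompositeProblem

/-- Parameters of the method: selection probabilities `p` and step sizes `τ t`, `η t`, `α t`,
`t = 1, 2, …` (the values at `t = 0` are never used). -/
structure RPDGParams (m : ℕ) where
  p : Fin m → ℝ
  τ : ℕ → ℝ
  η : ℕ → ℝ
  α : ℕ → ℝ

/-- What the method stores after iteration `t`: the points `x^t` and `x^{t-1}`, the search points
`xs i` of the components, the component gradients `y i`, and their sum `g`. -/
structure RPDGState (n m : ℕ) where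
  x : Eucl n
  xPrev : Eucl n
  xs : Fin m → Eucl n
  y : Fin m → Eucl n
  g : Eucl n

variable {n m : ℕ}

/-- The starting state: `x^{-1} = x^0`, every search point is `x^0`, `y i = ∇ f_i(x^0)`,
`g = ∑ i, y i`. -/
def rpdgStart (P : CompositeProblem n m) (x0 : Eucl n) : RPDGState n m where
  x := x0
  xPrev := x0
  xs := fun _ => x0
  y := fun i => gradient (P.f i) x0
  g := ∑ i, gradient (P.f i) x0

/-- Iteration number `t` of the randomized primal-dual gradient method, with selected component
`j`. Only the gradient of `f j` is evaluated, at the new search point `xj`. -/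
def rpdgStep (P : CompositeProblem n m) (q : RPDGParams m) (t : ℕ) (j : Fin m)
    (s : RPDGState n m) : RPDGState n m :=
  let xTilde : Eucl n := q.α t • (s.x - s.xPrev) + s.x
  let xj : Eucl n := (1 + q.τ t)⁻¹ • (xTilde + q.τ t • s.xs j)
  let yj : Eucl n := gradient (P.f j) xj
  { x := P.proxMap (s.g + (q.p j)⁻¹ • (yj - s.y j)) s.x (q.η t)
    xPrev := s.x
    xs := Function.update s.xs j xj
    y := Function.update s.y j yj
    g := s.g + (yj - s.y j) }

/-- The state after `t` iterations, where `i t` is the component selected in iteration `t + 1`. -/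
def rpdgIter (P : CompositeProblem n m) (q : RPDGParams m) (x0 : Eucl n) (i : ℕ → Fin m) :
    ℕ → RPDGState n m
  | 0 => rpdgStart P x0
  | t + 1 => rpdgStep P q (t + 1) (i t) (rpdgIter P q x0 i t)

/-- The output after `k` iterations: the weighted ergodic mean
`(∑_{t=1}^k θ_t)⁻¹ ∑_{t=1}^k θ_t x^t`. -/
def rpdgMean (P : CompositeProblem n m) (q : RPDGParams m) (θ : ℕ → ℝ) (x0 : Eucl n)
    (i : ℕ → Fin m) (k : ℕ) : Eucl n :=
  (∑ t ∈ Finset.Icc 1 k, θ t)⁻¹ • ∑ t ∈ Finset.Icc 1 k, θ t • (rpdgIter P q x0 i t).x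

/-- The constant `α = 1 - 1 / ((m + 1) + √((m - 1)² + 4 m C))`. -/
def rpdgAlpha (m : ℕ) (C : ℝ) : ℝ :=
  1 - 1 / (((m : ℝ) + 1) + √(((m : ℝ) - 1) ^ 2 + 4 * m * C))

/-- The parameter setting with non-uniform selection probabilities, for Lipschitz constants `Lc i`
of the component gradients, strong convexity modulus `μ` and condition number `C`. -/
def nonuniformParams (Lc : Fin m → ℝ) (μ C : ℝ) : RPDGParams m where
  p := fun i => 1 / (2 * m) + Lc i / (2 * ∑ j, Lc j)
  τ := fun _ => (√(((m : ℝ) - 1) ^ 2 + 4 * m * C) - (m - 1)) / (2 * m)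
  η := fun _ => (μ * √(((m : ℝ) - 1) ^ 2 + 4 * m * C) + μ * (m - 1)) / 2
  α := fun _ => rpdgAlpha m C

/-- The weights `θ_t = α^{-t}` of the ergodic mean. -/
def nonuniformWeights (m : ℕ) (C : ℝ) (t : ℕ) : ℝ := 1 / rpdgAlpha m C ^ t

/-- The perturbed problem `min_x ∑ i, f i x + (δ / 2) ‖x - x0‖²` over all of `ℝⁿ`, written as a
composite problem with `h = 0`, `μ = δ` and `ω = ‖· - x0‖² / 2`. -/
def perturbedProblem (f : Fin m → Eucl n → ℝ) (x0 : Eucl n) (δ : ℝ) : CompositeProblem n m where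
  f := f
  X := Set.univ
  h := fun _ => 0
  ω := fun x => ‖x - x0‖ ^ 2 / 2
  μ := δ

theorem perturbedProblem_objective (f : Fin m → Eucl n → ℝ) (x0 : Eucl n) (δ : ℝ) (x : Eucl n) :
    (perturbedProblem f x0 δ).objective x = ∑ i, f i x + δ / 2 * ‖x - x0‖ ^ 2 := by
  simp only [CompositeProblem.objective, perturbedProblem]
  ring

/-- The set of global minimizers of a function on `ℝⁿ`. -/
def minimizers (F : Eucl n → ℝ) : Set (Eucl n) := {u | ∀ x, F u ≤ F x}

/-- The relative accuracy `2 [F(xbar) - F*] / (L (1 + dist(x0, X*)²))`, where `F* = inf F` and `X*`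
is the set of minimizers of `F`, assumed to be nonempty. -/
def relAccuracy (F : Eucl n → ℝ) (L : ℝ) (x0 xbar : Eucl n) : ℝ :=
  2 * (F xbar - ⨅ x, F x) / (L * (1 + Metric.infDist x0 (minimizers F) ^ 2))

/-- The relative accuracy, for minimizing `∑ i, f i`, of the output after `k` iterations of the
method applied to the perturbed problem with parameter `δ` from the starting point `x0`. -/
def rpdgRelAccuracy (f : Fin m → Eucl n → ℝ) (Lc : Fin m → ℝ) (x0 : Eucl n) (δ C : ℝ)
    (i : ℕ → Fin m) (k : ℕ) : ℝ :=
  relAccuracy (fun x => ∑ j, f j x) (∑ j, Lc j) x0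
    (rpdgMean (perturbedProblem f x0 δ) (nonuniformParams Lc δ C) (nonuniformWeights m C) x0 i k)

end

/-! Let `u` be the minimizer of the perturbed objective. The method is analysed through one
potential, `lyapunov`: a multiple of the squared distance to `u`, weighted Bregman distances of the
search points to `u`, and two terms carrying the last move `x^t - x^{t-1}`, one of them its pairing
with the error of the aggregated gradient.

In one iteration (`lyapunov_rpdgStep_le`) three things are combined: optimality of the primal prox
step, the three-point identity of the dual step, and cocoercivity, by which the Bregman gain of the
dual step pays for the square of the gradient change. What remains is a gain proportional to the old
Bregman distance of the selected component and a term linear in `p_j⁻¹ (y_j - ∇f_j(u)) - (g - ∑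
∇f_i(u))`, which has mean zero over `j`. So the conditional mean of the potential contracts by `α`
(`sum_lyapunov_rpdgStep_le`). As the potential dominates the squared distance (`lyapunov_ge`), the
iterates converge linearly in mean square. Jensen's inequality carries this over to the ergodic
mean, at the price of a factor `k`.

Finally, the original gap is at most `(L + δ)/2 ‖x - u‖²` plus the bias `δ/2 dist(x0, X*)²`. Since
`δ = Lε/2`, the bias uses at most half of the allowed accuracy. The rest is an expectation bound, or
Markov's inequality for the probability. The factor `k` and the polynomial prefactors in `1/ε` cost
only a constant multiple of the logarithm. -/

/-! ### Smooth convex functions and Bregman distances -/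

section SmoothConvex

variable {E : Type*} [NormedAddCommGroup E] [InnerProductSpace ℝ E] [CompleteSpace E]

/-- The Bregman distance `f a - f b - ⟨∇f(b), a - b⟩`. -/
noncomputable def bregman (f : E → ℝ) (a b : E) : ℝ := f a - f b - inner ℝ (gradient f b) (a - b)

theorem hasDerivAt_comp_segment {f : E → ℝ} (hf : Differentiable ℝ f) (a b : E) (t : ℝ) :
    HasDerivAt (fun s : ℝ => f (b + s • (a - b)))
      (inner ℝ (gradient f (b + t • (a - b))) (a - b)) t := by
  have h1 : HasDerivAt (fun s : ℝ => b + s • (a - b)) (a - b) t := by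
    simpa using ((hasDerivAt_id t).smul_const (a - b)).const_add b
  have h2 := (hf (b + t • (a - b))).hasFDerivAt.comp_hasDerivAt t h1
  rw [inner_gradient_left]
  exact h2

theorem bregman_nonneg {f : E → ℝ} (hf : Differentiable ℝ f) (hc : ConvexOn ℝ Set.univ f)
    (a b : E) : 0 ≤ bregman f a b := by
  have h1 : ConvexOn ℝ Set.univ (fun s : ℝ => f (b + s • (a - b))) := by
    have h := hc.comp_affineMap (AffineMap.lineMap b a : ℝ →ᵃ[ℝ] E)
    have e : f ∘ (AffineMap.lineMap b a : ℝ →ᵃ[ℝ] E) = fun s : ℝ => f (b + s • (a - b)) := by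
      ext s
      simp [AffineMap.lineMap_apply, add_comm]
    rwa [e, Set.preimage_univ] at h
  have h2 := hasDerivAt_comp_segment hf a b 0
  have h3 := h1.le_slope_of_hasDerivAt (Set.mem_univ 0) (Set.mem_univ 1) one_pos h2
  simp only [slope_def_field] at h3
  simp [-inner_gradient_left] at h3
  unfold bregman
  linarith

/-- Along the segment from `b` to `a`, the function minus its quadratic upper model has nonpositive
derivative by Cauchy-Schwarz and the Lipschitz bound; monotonicity replaces integration. -/
theorem bregman_le {f : E → ℝ} (hf : Differentiable ℝ f) {K : ℝ}
    (hL : ∀ x y, ‖gradient f x - gradient f y‖ ≤ K * ‖x - y‖) (a b : E) :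
    bregman f a b ≤ K / 2 * ‖a - b‖ ^ 2 := by
  set φ : ℝ → ℝ := fun s => f (b + s • (a - b)) - s * inner ℝ (gradient f b) (a - b)
    - K / 2 * ‖a - b‖ ^ 2 * s ^ 2 with hφ
  have hd : ∀ t : ℝ, HasDerivAt φ (inner ℝ (gradient f (b + t • (a - b))) (a - b)
      - inner ℝ (gradient f b) (a - b) - K * ‖a - b‖ ^ 2 * t) t := by
    intro t
    have h1 := ((hasDerivAt_comp_segment hf a b t).sub
      ((hasDerivAt_id t).mul_const (inner ℝ (gradient f b) (a - b)))).sub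
      ((hasDerivAt_pow 2 t).const_mul (K / 2 * ‖a - b‖ ^ 2))
    refine HasDerivAt.congr_deriv (f := φ) h1 ?_
    simp only [Nat.cast_ofNat]
    ring
  have hanti : AntitoneOn φ (Set.Icc 0 1) := by
    apply antitoneOn_of_deriv_nonpos (convex_Icc 0 1)
    · exact fun t _ => (hd t).continuousAt.continuousWithinAt
    · exact fun t _ => (hd t).differentiableAt.differentiableWithinAt
    · intro t ht
      rw [interior_Icc] at ht
      rw [(hd t).deriv, ← inner_sub_left]
      have h1 := real_inner_le_norm (gradient f (b + t • (a - b)) - gradient f b) (a - b)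
      have h2 := hL (b + t • (a - b)) b
      rw [add_sub_cancel_left, norm_smul, Real.norm_of_nonneg ht.1.le] at h2
      nlinarith [mul_le_mul_of_nonneg_right h2 (norm_nonneg (a - b))]
  have h := hanti (Set.left_mem_Icc.2 zero_le_one) (Set.right_mem_Icc.2 zero_le_one) zero_le_one
  simp only [hφ] at h
  simp [-inner_gradient_left] at h
  unfold bregman
  linarith

/-- At `z = a - K⁻¹ (∇f(a) - ∇f(b))` the quadratic upper model built at `a` must lie above the
linear lower model built at `b`. For `K = 0` the gradient is constant. -/
theorem norm_gradient_sub_sq_le {f : E → ℝ} (hf : Differentiable ℝ f)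
    (hc : ConvexOn ℝ Set.univ f) {K : ℝ} (hK : 0 ≤ K)
    (hL : ∀ x y, ‖gradient f x - gradient f y‖ ≤ K * ‖x - y‖) (a b : E) :
    ‖gradient f a - gradient f b‖ ^ 2 ≤ 2 * K * bregman f a b := by
  rcases hK.eq_or_lt with rfl | hK
  · have h := hL a b
    rw [zero_mul] at h
    simp [le_antisymm h (norm_nonneg _)]
  set d := gradient f a - gradient f b with hd
  set z := a - K⁻¹ • d with hz
  have h1 := bregman_le hf hL z a
  have h2 := bregman_nonneg hf hc z b
  unfold bregman at *
  have e1 : z - a = -(K⁻¹ • d) := by rw [hz]; abel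
  have e2 : z - b = (a - b) - K⁻¹ • d := by rw [hz]; abel
  rw [e1, norm_neg, norm_smul, Real.norm_of_nonneg (by positivity), inner_neg_right,
    real_inner_smul_right] at h1
  rw [e2, inner_sub_right, real_inner_smul_right] at h2
  have h3 : inner ℝ (gradient f a) d - inner ℝ (gradient f b) d = ‖d‖ ^ 2 := by
    rw [← inner_sub_left, real_inner_self_eq_norm_sq]
  have h4 : K⁻¹ * inner ℝ (gradient f a) d - K⁻¹ * inner ℝ (gradient f b) d = K⁻¹ * ‖d‖ ^ 2 := by
    rw [← h3]; ring
  have h5 : K / 2 * (K⁻¹ * ‖d‖) ^ 2 = K⁻¹ * ‖d‖ ^ 2 / 2 := by field_simp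
  have h6 : K⁻¹ * ‖d‖ ^ 2 ≤ 2 * (f a - f b - inner ℝ (gradient f b) (a - b)) := by linarith
  calc ‖d‖ ^ 2 = K * (K⁻¹ * ‖d‖ ^ 2) := by field_simp
    _ ≤ K * (2 * (f a - f b - inner ℝ (gradient f b) (a - b))) := by gcongr
    _ = _ := by ring

/-- The three-point identity of a dual proximal step `(1 + τ) a = x + τ b`. -/
theorem bregman_dual_step (f : E → ℝ) {τ : ℝ} {a b x : E} (h : (1 + τ) • a = x + τ • b) (u : E) :
    (1 + τ) * bregman f a u = τ * bregman f b u - τ * bregman f b a - bregman f u a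
      + inner ℝ (x - u) (gradient f a - gradient f u) := by
  have e : x - u = (a - u) + τ • (a - b) := by
    have hx : x = (1 + τ) • a - τ • b := by rw [h]; abel
    rw [hx]; module
  rw [e]
  unfold bregman
  rw [real_inner_comm (gradient f a - gradient f u)]
  simp only [inner_sub_right, inner_sub_left, inner_add_right, real_inner_smul_right]
  ring

end SmoothConvex

/-! ### The prox-mapping of the perturbed problem -/

theorem hasGradientAt_half_norm_sub_sq {E : Type*} [NormedAddCommGroup E] [InnerProductSpace ℝ E]
    [CompleteSpace E] (x0 u : E) :
    HasGradientAt (fun x : E => ‖x - x0‖ ^ 2 / 2) (u - x0) u := by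
  rw [hasGradientAt_iff_hasFDerivAt]
  have h := (((hasFDerivAt_id u).sub_const x0).norm_sq).mul_const (1 / 2 : ℝ)
  refine (h.congr_fderiv ?_).congr_of_eventuallyEq ?_
  · ext v
    simp
  · exact Filter.Eventually.of_forall fun x => by simp [div_eq_mul_inv]

theorem perturbedProblem_proxFun {n m : ℕ} (f : Fin m → Eucl n → ℝ) (x0 : Eucl n) (δ : ℝ)
    (u x : Eucl n) : (perturbedProblem f x0 δ).proxFun u x = ‖x - u‖ ^ 2 / 2 := by
  simp only [CompositeProblem.proxFun, perturbedProblem]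
  rw [(hasGradientAt_half_norm_sub_sq x0 u).gradient]
  have e : x - x0 = (x - u) + (u - x0) := by abel
  rw [e, norm_add_sq_real, real_inner_comm]
  ring

/-- Optimality condition of the primal prox-mapping of the perturbed problem. -/
theorem perturbedProblem_proxMap {n m : ℕ} (f : Fin m → Eucl n → ℝ) (x0 : Eucl n) {δ η : ℝ}
    (h : 0 < δ + η) (g u : Eucl n) :
    g + δ • ((perturbedProblem f x0 δ).proxMap g u η - x0)
      + η • ((perturbedProblem f x0 δ).proxMap g u η - u) = 0 := by
  set P := perturbedProblem f x0 δ with hP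
  set F : Eucl n → ℝ := fun x => inner ℝ g x + P.h x + P.μ * P.ω x + η * P.proxFun u x with hF
  have hFx : ∀ x, F x = inner ℝ g x + δ * (‖x - x0‖ ^ 2 / 2) + η * (‖x - u‖ ^ 2 / 2) := by
    intro x
    simp only [hF, hP, perturbedProblem_proxFun]
    simp [perturbedProblem]
  set z : Eucl n := (δ + η)⁻¹ • (δ • x0 + η • u - g) with hz
  have hzg : g = δ • (x0 - z) + η • (u - z) := by
    have h1 : (δ + η) • z = δ • x0 + η • u - g := by rw [hz, smul_inv_smul₀ h.ne']
    have h2 : g = δ • x0 + η • u - (δ + η) • z := by rw [h1]; abel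
    rw [h2]; module
  -- The prox objective is an exact quadratic centred at `z`. This gives existence and uniqueness of
  -- the minimizer, so the choice made by `Classical.epsilon` must be `z`.
  have hquad : ∀ x, F x = F z + (δ + η) / 2 * ‖x - z‖ ^ 2 := by
    intro x
    rw [hFx, hFx]
    have e1 : x - x0 = (x - z) - (x0 - z) := by abel
    have e2 : x - u = (x - z) - (u - z) := by abel
    have e3 : inner ℝ g x = inner ℝ g z + inner ℝ g (x - z) := by rw [← inner_add_right]; simp
    have e4 : inner ℝ g (x - z) = δ * inner ℝ (x - z) (x0 - z) + η * inner ℝ (x - z) (u - z) := by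
      rw [real_inner_comm, hzg, inner_add_right, real_inner_smul_right, real_inner_smul_right]
    rw [e1, e2, e3, e4, norm_sub_sq_real (x - z) (x0 - z), norm_sub_sq_real (x - z) (u - z), ← norm_sub_rev x0 z,
      ← norm_sub_rev u z]
    ring
  have hex : ∃ x, x ∈ P.X ∧ IsMinOn F P.X x := by
    refine ⟨z, trivial, fun x _ => ?_⟩
    simp only [Set.mem_ofPred_eq]
    rw [hquad x]
    have : 0 ≤ (δ + η) / 2 * ‖x - z‖ ^ 2 := by positivity
    linarith
  have heq : P.proxMap g u η = z := by
    change (Classical.epsilon fun x => x ∈ P.X ∧ IsMinOn F P.X x) = z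
    set w := Classical.epsilon fun x => x ∈ P.X ∧ IsMinOn F P.X x
    have hspec : w ∈ P.X ∧ IsMinOn F P.X w := Classical.epsilon_spec hex
    have h1 : F w ≤ F z := isMinOn_iff.1 hspec.2 z trivial
    rw [hquad w] at h1
    have h2 : ‖w - z‖ ^ 2 ≤ 0 := by
      by_contra hcon
      have : 0 < (δ + η) / 2 * ‖w - z‖ ^ 2 := mul_pos (by positivity) (not_le.1 hcon)
      linarith
    have h3 : ‖w - z‖ = 0 := by
      have := sq_nonneg ‖w - z‖
      exact pow_eq_zero_iff (two_ne_zero) |>.1 (le_antisymm h2 this)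
    exact sub_eq_zero.1 (norm_eq_zero.1 h3)
  rw [heq, hzg]
  module

/-! ### The Lyapunov function and its contraction in one step -/

/-- One primal step: `e`, `e'` are the old and new errors, `d` is the previous move, `G` the error
of the averaged gradient and `p • v` its last change. -/
theorem primal_energy_le {E : Type*} [NormedAddCommGroup E] [InnerProductSpace ℝ E]
    {e e' d G v : E} {μ η α p : ℝ} (hη : 0 < η) (hα0 : 0 ≤ α) (hα1 : α ≤ 1) (hp0 : 0 ≤ p)
    (hp1 : p ≤ 1) (hopt : G + v + μ • e' + η • (e' - e) = 0) :
    (μ + η / 2) * ‖e'‖ ^ 2 + inner ℝ (G + p • v) (e' - e) + η / 4 * ‖e' - e‖ ^ 2 ≤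
      η / 2 * ‖e‖ ^ 2 + α * inner ℝ G d + α * (η / 4) * ‖d‖ ^ 2 + 2 / η * ‖v‖ ^ 2
        - inner ℝ (G + v) (α • d + e) := by
  have h1 : inner ℝ (G + v) e' + μ * ‖e'‖ ^ 2
      + η / 2 * (‖e'‖ ^ 2 + ‖e' - e‖ ^ 2 - ‖e‖ ^ 2) = 0 := by
    have h : inner ℝ (G + v + μ • e' + η • (e' - e)) e' = (0 : ℝ) := by rw [hopt, inner_zero_left]
    rw [inner_add_left, inner_add_left, real_inner_smul_left, real_inner_smul_left, inner_sub_left,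
      real_inner_self_eq_norm_sq] at h
    rw [norm_sub_sq_real, real_inner_comm e e']
    linarith
  -- Two cross terms remain. Half of the `η/2 ‖e' - e‖²` from the prox step absorbs `(1 - p)⟨v, e' -
  -- e⟩`, and the carried `α η/4 ‖d‖²` absorbs `α⟨v, d⟩`. Each costs at most `‖v‖²/η`.
  have h2 : 0 ≤ η / 4 * ‖(e' - e) + (2 * (1 - p) / η) • v‖ ^ 2 := by positivity
  have h3 : 0 ≤ α * (η / 4) * ‖d - (2 / η) • v‖ ^ 2 := by positivity
  have e2 : η / 4 * ‖(e' - e) + (2 * (1 - p) / η) • v‖ ^ 2 = η / 4 * ‖e' - e‖ ^ 2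
      + (1 - p) * inner ℝ v (e' - e) + (1 - p) ^ 2 * (1 / η * ‖v‖ ^ 2) := by
    rw [norm_add_sq_real, real_inner_smul_right, norm_smul, Real.norm_eq_abs, mul_pow, sq_abs,
      real_inner_comm]
    field_simp
    ring
  have e3 : α * (η / 4) * ‖d - (2 / η) • v‖ ^ 2 = α * (η / 4) * ‖d‖ ^ 2
      - α * inner ℝ v d + α * (1 / η * ‖v‖ ^ 2) := by
    rw [norm_sub_sq_real, real_inner_smul_right, norm_smul, Real.norm_eq_abs, mul_pow, sq_abs,
      real_inner_comm]
    field_simp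
    ring
  have hv : 0 ≤ 1 / η * ‖v‖ ^ 2 := by positivity
  have h4 : (1 - p) ^ 2 * (1 / η * ‖v‖ ^ 2) ≤ 1 * (1 / η * ‖v‖ ^ 2) := by
    gcongr
    nlinarith
  have h5 : α * (1 / η * ‖v‖ ^ 2) ≤ 1 * (1 / η * ‖v‖ ^ 2) := by gcongr
  have e4 : 2 / η * ‖v‖ ^ 2 = 1 * (1 / η * ‖v‖ ^ 2) + 1 * (1 / η * ‖v‖ ^ 2) := by ring
  rw [e4]
  simp only [inner_add_left, inner_add_right, inner_sub_right, real_inner_smul_left,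
    real_inner_smul_right] at *
  linarith

/-- Parameters that do not depend on the iteration. -/
def constParams {m : ℕ} (p : Fin m → ℝ) (τ η α : ℝ) : RPDGParams m where
  p := p
  τ := fun _ => τ
  η := fun _ => η
  α := fun _ => α

/-- The stored gradients are those at the search points, and `g` is their sum. -/
def RPDGState.Consistent {n m : ℕ} (f : Fin m → Eucl n → ℝ) (s : RPDGState n m) : Prop :=
  (∀ i, s.y i = gradient (f i) (s.xs i)) ∧ s.g = ∑ i, s.y i

theorem rpdgStep_consistent {n m : ℕ} (f : Fin m → Eucl n → ℝ) (x0 : Eucl n) (δ : ℝ)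
    (q : RPDGParams m) (t : ℕ) (j : Fin m) {s : RPDGState n m} (hs : s.Consistent f) :
    (rpdgStep (perturbedProblem f x0 δ) q t j s).Consistent f := by
  refine ⟨fun i => ?_, ?_⟩
  · by_cases hij : i = j
    · subst hij
      simp [rpdgStep, perturbedProblem]
    · simp [rpdgStep, perturbedProblem, hij, hs.1 i]
  · simp only [rpdgStep]
    rw [Finset.sum_update_of_mem (Finset.mem_univ j), hs.2,
      ← Finset.add_sum_erase _ _ (Finset.mem_univ j), Finset.sdiff_singleton_eq_erase]
    abel

theorem rpdgIter_consistent {n m : ℕ} (f : Fin m → Eucl n → ℝ) (x0 : Eucl n) (δ : ℝ)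
    (q : RPDGParams m) (i : ℕ → Fin m) (t : ℕ) :
    (rpdgIter (perturbedProblem f x0 δ) q x0 i t).Consistent f := by
  induction t with
  | zero => exact ⟨fun _ => rfl, rfl⟩
  | succ t ih => exact rpdgStep_consistent f x0 δ q (t + 1) (i t) ih

/-- The Lyapunov function of the method, for the reference point `u`. -/
noncomputable def lyapunov {n m : ℕ} (f : Fin m → Eucl n → ℝ) (p : Fin m → ℝ) (μ τ η : ℝ)
    (u : Eucl n) (s : RPDGState n m) : ℝ :=
  (μ + η / 2) * ‖s.x - u‖ ^ 2 + ∑ i, (1 + τ) / p i * bregman (f i) (s.xs i) u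
    + inner ℝ (s.g - ∑ i, gradient (f i) u) (s.x - s.xPrev) + η / 4 * ‖s.x - s.xPrev‖ ^ 2

/-- A pathwise bound, before averaging over `j`. The extrapolated point enters both the primal and
the dual estimate, and pairing them cancels the new gradient `y_j^t`, so the last inner product
involves old quantities only. -/
theorem lyapunov_rpdgStep_le {n m : ℕ} {f : Fin m → Eucl n → ℝ} {Lc : Fin m → ℝ} {L : ℝ}
    {x0 u : Eucl n} {p : Fin m → ℝ} {μ τ η α : ℝ}
    (hf : ∀ j, Differentiable ℝ (f j)) (hc : ∀ j, ConvexOn ℝ Set.univ (f j)) (hL0 : ∀ j, 0 ≤ Lc j)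
    (hL : ∀ j x y, ‖gradient (f j) x - gradient (f j) y‖ ≤ Lc j * ‖x - y‖)
    (hu : ∑ i, gradient (f i) u + μ • (u - x0) = 0)
    (hμ : 0 < μ) (hτ : 0 ≤ τ) (hη : 0 < η) (hα0 : 0 ≤ α) (hα1 : α ≤ 1)
    (hp0 : ∀ j, 0 < p j) (hp1 : ∀ j, p j ≤ 1) (hpL : ∀ j, Lc j ≤ 2 * L * p j)
    (hτη : 8 * L ≤ τ * η) (t : ℕ) (j : Fin m) {s : RPDGState n m} (hs : s.Consistent f) :
    lyapunov f p μ τ η u (rpdgStep (perturbedProblem f x0 μ) (constParams p τ η α) t j s) ≤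
      η / 2 * ‖s.x - u‖ ^ 2 + ∑ i, (1 + τ) / p i * bregman (f i) (s.xs i) u
      + α * inner ℝ (s.g - ∑ i, gradient (f i) u) (s.x - s.xPrev)
      + α * (η / 4) * ‖s.x - s.xPrev‖ ^ 2
      - (p j)⁻¹ * bregman (f j) (s.xs j) u
      + inner ℝ (α • (s.x - s.xPrev) + (s.x - u))
        ((p j)⁻¹ • (s.y j - gradient (f j) u) - (s.g - ∑ i, gradient (f i) u)) := by
  set gs := ∑ i, gradient (f i) u with hgs
  set xt := α • (s.x - s.xPrev) + s.x with hxt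
  set a := (1 + τ)⁻¹ • (xt + τ • s.xs j) with ha
  set ya := gradient (f j) a with hya
  set v := (p j)⁻¹ • (ya - s.y j) with hv
  set xn := (perturbedProblem f x0 μ).proxMap (s.g + v) s.x η with hxn
  have hprox : s.g + v + μ • (xn - x0) + η • (xn - s.x) = 0 :=
    perturbedProblem_proxMap f x0 (add_pos hμ hη) _ _
  have hpj := hp0 j
  have hpv : p j • v = ya - s.y j := by rw [hv, smul_inv_smul₀ hpj.ne']
  -- Subtracting the stationarity condition of `u` removes `x0`.
  have hopt : (s.g - gs) + v + μ • (xn - u) + η • ((xn - u) - (s.x - u)) = 0 := by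
    have h := congrArg₂ (· - ·) hprox hu
    simp only [sub_zero] at h
    rw [← h]
    module
  have hA := primal_energy_le (d := s.x - s.xPrev) hη hα0 hα1 hpj.le (hp1 j) hopt
  rw [hpv, sub_sub_sub_cancel_right] at hA
  have hdual := bregman_dual_step (f j) (τ := τ) (a := a) (b := s.xs j) (x := xt)
    (by rw [ha, smul_inv_smul₀ (by positivity)]) u
  have hBua := bregman_nonneg (hf j) (hc j) u a
  have hBba := bregman_nonneg (hf j) (hc j) (s.xs j) a
  -- Cocoercivity and `Lc j ≤ 2 L p j` give `‖v‖² ≤ (4L / p j) B`; this is where `8 L ≤ τ η` is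
  -- needed. The right side is the gain supplied by `bregman_dual_step`.
  have hvn : 2 / η * ‖v‖ ^ 2 ≤ (p j)⁻¹ * (τ * bregman (f j) (s.xs j) a) := by
    have h1 := norm_gradient_sub_sq_le (hf j) (hc j) (hL0 j) (hL j) (s.xs j) a
    rw [← hs.1 j, norm_sub_rev] at h1
    have h2 : ‖ya - s.y j‖ ^ 2 ≤ 4 * L * p j * bregman (f j) (s.xs j) a :=
      h1.trans (by nlinarith [mul_le_mul_of_nonneg_right (hpL j) hBba])
    rw [hv, norm_smul, Real.norm_of_nonneg (by positivity), mul_pow]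
    calc 2 / η * ((p j)⁻¹ ^ 2 * ‖ya - s.y j‖ ^ 2)
        ≤ 2 / η * ((p j)⁻¹ ^ 2 * (4 * L * p j * bregman (f j) (s.xs j) a)) := by gcongr
      _ = (p j)⁻¹ * (8 * L / η * bregman (f j) (s.xs j) a) := by field_simp; ring
      _ ≤ (p j)⁻¹ * (τ * bregman (f j) (s.xs j) a) := by
        gcongr
        rwa [div_le_iff₀ hη]
  have hsum : ∑ i, (1 + τ) / p i * bregman (f i) (Function.update s.xs j a i) u
      = ∑ i, (1 + τ) / p i * bregman (f i) (s.xs i) u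
        + (p j)⁻¹ * ((1 + τ) * bregman (f j) a u - (1 + τ) * bregman (f j) (s.xs j) u) := by
    rw [← sub_eq_iff_eq_add', ← Finset.sum_sub_distrib, Finset.sum_eq_single j]
    · rw [Function.update_self]
      field_simp
    · intro i _ hij
      rw [Function.update_of_ne hij, sub_self]
    · simp
  have hstep : lyapunov f p μ τ η u
      (rpdgStep (perturbedProblem f x0 μ) (constParams p τ η α) t j s) =
      (μ + η / 2) * ‖xn - u‖ ^ 2
      + ∑ i, (1 + τ) / p i * bregman (f i) (Function.update s.xs j a i) u
      + inner ℝ (s.g + (ya - s.y j) - gs) (xn - s.x) + η / 4 * ‖xn - s.x‖ ^ 2 := rfl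
  rw [hstep, hsum, hdual]
  have e1 : s.g + (ya - s.y j) - gs = s.g - gs + (ya - s.y j) := by abel
  have e2 : xt - u = α • (s.x - s.xPrev) + (s.x - u) := by rw [hxt]; abel
  have e3 : (p j)⁻¹ • (s.y j - gradient (f j) u) - (s.g - gs)
      = (p j)⁻¹ • (ya - gradient (f j) u) - (s.g - gs + v) := by rw [hv]; module
  rw [e1, e2, e3, inner_sub_right _ ((p j)⁻¹ • _), real_inner_smul_right,
    real_inner_comm (s.g - gs + v)]
  have hB' : 0 ≤ (p j)⁻¹ * bregman (f j) u a := by positivity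
  linarith

/-- The factor `p j` cancels the `(p j)⁻¹` of the Bregman gain, so averaging subtracts the full sum
of the Bregman distances. The two parameter conditions `hηα` and `hpα` say that the distance part
and the Bregman part each contract by `α`. -/
theorem sum_lyapunov_rpdgStep_le {n m : ℕ} {f : Fin m → Eucl n → ℝ} {Lc : Fin m → ℝ} {L : ℝ}
    {x0 u : Eucl n} {p : Fin m → ℝ} {μ τ η α : ℝ}
    (hf : ∀ j, Differentiable ℝ (f j)) (hc : ∀ j, ConvexOn ℝ Set.univ (f j)) (hL0 : ∀ j, 0 ≤ Lc j)
    (hL : ∀ j x y, ‖gradient (f j) x - gradient (f j) y‖ ≤ Lc j * ‖x - y‖)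
    (hu : ∑ i, gradient (f i) u + μ • (u - x0) = 0)
    (hμ : 0 < μ) (hτ : 0 ≤ τ) (hη : 0 < η) (hα0 : 0 ≤ α) (hα1 : α ≤ 1)
    (hp0 : ∀ j, 0 < p j) (hpsum : ∑ j, p j = 1) (hpL : ∀ j, Lc j ≤ 2 * L * p j)
    (hτη : 8 * L ≤ τ * η) (hηα : η / 2 ≤ α * (μ + η / 2))
    (hpα : ∀ j, (1 - α) * (1 + τ) ≤ p j) (t : ℕ) {s : RPDGState n m} (hs : s.Consistent f) :
    ∑ j, p j * lyapunov f p μ τ η u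
      (rpdgStep (perturbedProblem f x0 μ) (constParams p τ η α) t j s) ≤
      α * lyapunov f p μ τ η u s := by
  have hp1 : ∀ j, p j ≤ 1 := fun j => by
    rw [← hpsum]
    exact Finset.single_le_sum (fun i _ => (hp0 i).le) (Finset.mem_univ j)
  set gs := ∑ i, gradient (f i) u with hgs
  set w := α • (s.x - s.xPrev) + (s.x - u) with hw
  set R := η / 2 * ‖s.x - u‖ ^ 2 + ∑ i, (1 + τ) / p i * bregman (f i) (s.xs i) u
      + α * inner ℝ (s.g - gs) (s.x - s.xPrev)
      + α * (η / 4) * ‖s.x - s.xPrev‖ ^ 2 with hR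
  -- Importance weighting makes the gradient error of one component an unbiased estimate of the
  -- total error.
  have hinner : ∑ j, p j * inner ℝ w ((p j)⁻¹ • (s.y j - gradient (f j) u) - (s.g - gs)) = 0 := by
    have e : ∀ j, p j * inner ℝ w ((p j)⁻¹ • (s.y j - gradient (f j) u) - (s.g - gs))
        = inner ℝ w (s.y j - gradient (f j) u) - p j * inner ℝ w (s.g - gs) := fun j => by
      rw [inner_sub_right, real_inner_smul_right, mul_sub, ← mul_assoc,
        mul_inv_cancel₀ (hp0 j).ne', one_mul]
    rw [Finset.sum_congr rfl fun j _ => e j, Finset.sum_sub_distrib, ← Finset.sum_mul, hpsum,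
      ← inner_sum, Finset.sum_sub_distrib, ← hs.2, one_mul, sub_self]
  have h1 : ∑ j, p j * lyapunov f p μ τ η u
      (rpdgStep (perturbedProblem f x0 μ) (constParams p τ η α) t j s) ≤
      R - ∑ j, bregman (f j) (s.xs j) u := by
    calc _ ≤ ∑ j, p j * (R - (p j)⁻¹ * bregman (f j) (s.xs j) u
          + inner ℝ w ((p j)⁻¹ • (s.y j - gradient (f j) u) - (s.g - gs))) := by
          refine Finset.sum_le_sum fun j _ => mul_le_mul_of_nonneg_left ?_ (hp0 j).le
          exact lyapunov_rpdgStep_le hf hc hL0 hL hu hμ hτ hη hα0 hα1 hp0 hp1 hpL hτη t j hs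
      _ = ∑ j, (p j * R - bregman (f j) (s.xs j) u
          + p j * inner ℝ w ((p j)⁻¹ • (s.y j - gradient (f j) u) - (s.g - gs))) := by
          refine Finset.sum_congr rfl fun j _ => ?_
          rw [mul_add, mul_sub, ← mul_assoc (p j) (p j)⁻¹, mul_inv_cancel₀ (hp0 j).ne', one_mul]
      _ = _ := by
          rw [Finset.sum_add_distrib, Finset.sum_sub_distrib, ← Finset.sum_mul, hpsum, hinner]
          ring
  have h2 : ∑ i, (1 + τ) / p i * bregman (f i) (s.xs i) u - ∑ j, bregman (f j) (s.xs j) u ≤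
      α * ∑ i, (1 + τ) / p i * bregman (f i) (s.xs i) u := by
    rw [← Finset.sum_sub_distrib, Finset.mul_sum]
    refine Finset.sum_le_sum fun i _ => ?_
    have hB := bregman_nonneg (hf i) (hc i) (s.xs i) u
    have h3 : (1 - α) * ((1 + τ) / p i) ≤ 1 := by
      rw [← mul_div_assoc, div_le_one (hp0 i)]
      exact hpα i
    nlinarith [mul_le_mul_of_nonneg_right h3 hB]
  have h3 : η / 2 * ‖s.x - u‖ ^ 2 ≤ α * (μ + η / 2) * ‖s.x - u‖ ^ 2 := by gcongr
  refine h1.trans ?_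
  unfold lyapunov
  rw [hR]
  linarith

/-- The pairing term may be negative, but completing the square with `η/4 ‖d‖²` costs `‖G‖²/η`, and
the Bregman sum dominates this by weighted Cauchy-Schwarz and cocoercivity. -/
theorem lyapunov_ge {n m : ℕ} {f : Fin m → Eucl n → ℝ} {Lc : Fin m → ℝ} {L : ℝ}
    {u : Eucl n} {p : Fin m → ℝ} {μ τ η : ℝ}
    (hf : ∀ j, Differentiable ℝ (f j)) (hc : ∀ j, ConvexOn ℝ Set.univ (f j)) (hL0 : ∀ j, 0 ≤ Lc j)
    (hL : ∀ j x y, ‖gradient (f j) x - gradient (f j) y‖ ≤ Lc j * ‖x - y‖)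
    (hLpos : 0 < L) (hτ : 0 ≤ τ) (hη : 0 < η)
    (hp0 : ∀ j, 0 < p j) (hpsum : ∑ j, p j = 1) (hpL : ∀ j, Lc j ≤ 2 * L * p j)
    (hτη : 8 * L ≤ τ * η) {s : RPDGState n m} (hs : s.Consistent f) :
    (μ + η / 2) * ‖s.x - u‖ ^ 2 ≤ lyapunov f p μ τ η u s := by
  have hp1 : ∀ j, p j ≤ 1 := fun j => by
    rw [← hpsum]
    exact Finset.single_le_sum (fun i _ => (hp0 i).le) (Finset.mem_univ j)
  set G := s.g - ∑ i, gradient (f i) u with hG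
  set d := s.x - s.xPrev with hd
  have hGn : ‖G‖ ^ 2 ≤ ∑ i, ‖s.y i - gradient (f i) u‖ ^ 2 / p i := by
    have h1 : ‖G‖ ≤ ∑ i, ‖s.y i - gradient (f i) u‖ := by
      rw [hG, hs.2, ← Finset.sum_sub_distrib]
      exact norm_sum_le _ _
    calc ‖G‖ ^ 2 ≤ (∑ i, ‖s.y i - gradient (f i) u‖) ^ 2 := by gcongr
      _ = (∑ i, ‖s.y i - gradient (f i) u‖) ^ 2 / ∑ i, p i := by rw [hpsum, div_one]
      _ ≤ _ := Finset.sq_sum_div_le_sum_sq_div _ _ fun i _ => hp0 i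
  have hterm : ∀ i, ‖s.y i - gradient (f i) u‖ ^ 2 / p i * (1 / η) ≤
      (1 + τ) / p i * bregman (f i) (s.xs i) u := by
    intro i
    have hB := bregman_nonneg (hf i) (hc i) (s.xs i) u
    have h1 := norm_gradient_sub_sq_le (hf i) (hc i) (hL0 i) (hL i) (s.xs i) u
    rw [← hs.1 i] at h1
    have h2 : Lc i ≤ 2 * L := (hpL i).trans (by nlinarith [hp1 i])
    have h3 : ‖s.y i - gradient (f i) u‖ ^ 2 ≤ (1 + τ) * η * bregman (f i) (s.xs i) u :=
      h1.trans (mul_le_mul_of_nonneg_right (by nlinarith) hB)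
    have hpi := hp0 i
    calc ‖s.y i - gradient (f i) u‖ ^ 2 / p i * (1 / η)
        ≤ (1 + τ) * η * bregman (f i) (s.xs i) u / p i * (1 / η) := by gcongr
      _ = _ := by field_simp
  have hsum : 1 / η * ‖G‖ ^ 2 ≤ ∑ i, (1 + τ) / p i * bregman (f i) (s.xs i) u := by
    calc 1 / η * ‖G‖ ^ 2 ≤ 1 / η * ∑ i, ‖s.y i - gradient (f i) u‖ ^ 2 / p i := by gcongr
      _ = ∑ i, ‖s.y i - gradient (f i) u‖ ^ 2 / p i * (1 / η) := by
        rw [mul_comm, Finset.sum_mul]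
      _ ≤ _ := Finset.sum_le_sum fun i _ => hterm i
  have hsq : 0 ≤ η / 4 * ‖d + (2 / η) • G‖ ^ 2 := by positivity
  have e : η / 4 * ‖d + (2 / η) • G‖ ^ 2 = η / 4 * ‖d‖ ^ 2 + inner ℝ G d + 1 / η * ‖G‖ ^ 2 := by
    rw [norm_add_sq_real, real_inner_smul_right, norm_smul, Real.norm_eq_abs, mul_pow, sq_abs,
      real_inner_comm]
    field_simp
    ring
  unfold lyapunov
  linarith

/-- The terms with the last move vanish because `x^{-1} = x^0`; the lower bound on `p` keeps the
Bregman weights of order `m`. -/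
theorem lyapunov_start_le {n m : ℕ} {f : Fin m → Eucl n → ℝ} {Lc : Fin m → ℝ}
    {x0 u : Eucl n} {p : Fin m → ℝ} {μ τ η : ℝ} 
    (hf : ∀ j, Differentiable ℝ (f j)) (hL0 : ∀ j, 0 ≤ Lc j)
    (hL : ∀ j x y, ‖gradient (f j) x - gradient (f j) y‖ ≤ Lc j * ‖x - y‖)
    (hτ : 0 ≤ τ) (hp : ∀ j, 1 / (2 * m) ≤ p j) :
    lyapunov f p μ τ η u (rpdgStart (perturbedProblem f x0 μ) x0) ≤
      (μ + η / 2 + m * (1 + τ) * ∑ i, Lc i) * ‖x0 - u‖ ^ 2 := by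
  have h1 : ∀ i, (1 + τ) / p i * bregman (f i) x0 u ≤ m * (1 + τ) * Lc i * ‖x0 - u‖ ^ 2 := by
    intro i
    have hm : (0 : ℝ) < m := by exact_mod_cast i.pos
    have hp0 : 0 < p i := lt_of_lt_of_le (by positivity) (hp i)
    have h2 : (1 + τ) / p i ≤ (1 + τ) * (2 * m) := by
      rw [div_le_iff₀ hp0]
      have h3 : 1 ≤ 2 * m * p i := by
        have := hp i
        rw [div_le_iff₀ (by positivity)] at this
        linarith
      nlinarith
    have h3 := hL0 i
    calc (1 + τ) / p i * bregman (f i) x0 u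
        ≤ (1 + τ) / p i * (Lc i / 2 * ‖x0 - u‖ ^ 2) := by
          gcongr
          exact bregman_le (hf i) (hL i) x0 u
      _ ≤ (1 + τ) * (2 * m) * (Lc i / 2 * ‖x0 - u‖ ^ 2) := by gcongr
      _ = _ := by ring
  have h2 : ∑ i, (1 + τ) / p i * bregman (f i) x0 u ≤
      m * (1 + τ) * (∑ i, Lc i) * ‖x0 - u‖ ^ 2 := by
    rw [Finset.mul_sum, Finset.sum_mul]
    exact Finset.sum_le_sum fun i _ => h1 i
  simp only [lyapunov, rpdgStart, sub_self, inner_zero_right, norm_zero]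
  linarith

/-! ### Functions of the first `t` random indices -/

section RandomIndices

variable {m : ℕ} {Ω : Type*} [MeasurableSpace Ω] {ν : Measure Ω} [IsProbabilityMeasure ν]
  {i : ℕ → Ω → Fin m}

/-- Finitely many indices take finitely many values, so measurability and boundedness of every such
quantity follow without any regularity of `F`. -/
theorem exists_comp_of_dependsOn {F : (ℕ → Fin m) → ℝ} {t : ℕ}
    (hF : DependsOn F (Finset.range t : Set ℕ)) :
    ∃ H : ((s : Finset.range t) → Fin m) → ℝ, ∀ x : ℕ → Fin m, F x = H fun s => x s := by
  obtain ⟨H, hH⟩ := dependsOn_iff_exists_comp.1 hF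
  exact ⟨H, fun x => congrFun hH x⟩

theorem measurable_of_dependsOn (hi : ∀ t, Measurable (i t)) {F : (ℕ → Fin m) → ℝ} {t : ℕ}
    (hF : DependsOn F (Finset.range t : Set ℕ)) : Measurable fun w => F fun s => i s w := by
  obtain ⟨H, hH⟩ := exists_comp_of_dependsOn hF
  simp only [hH]
  exact (Measurable.of_discrete (f := H)).comp
    (measurable_pi_lambda (fun w (s : Finset.range t) => i s w) fun s => hi s)

theorem integrable_of_dependsOn (hi : ∀ t, Measurable (i t)) {F : (ℕ → Fin m) → ℝ} {t : ℕ}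
    (hF : DependsOn F (Finset.range t : Set ℕ)) : Integrable (fun w => F fun s => i s w) ν := by
  obtain ⟨H, hH⟩ := exists_comp_of_dependsOn hF
  obtain ⟨B, hB⟩ := (Set.finite_range fun h => ‖H h‖).bddAbove
  refine Integrable.of_bound (measurable_of_dependsOn hi hF).aestronglyMeasurable B
    (Filter.Eventually.of_forall fun w => ?_)
  rw [hH]
  exact hB ⟨_, rfl⟩

/-- Averaging over the next index, which is independent of the past. -/
theorem integral_next_index (hi : ∀ t, Measurable (i t)) (hind : iIndepFun i ν)
    {p : Fin m → ℝ} {t : ℕ} (hp : ∀ j, ν.real {w | i t w = j} = p j)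
    {G : Fin m → (ℕ → Fin m) → ℝ} (hG : ∀ j, DependsOn (G j) (Finset.range t : Set ℕ)) :
    ∫ w, G (i t w) (fun s => i s w) ∂ν = ∫ w, ∑ j, p j * G j (fun s => i s w) ∂ν := by
  choose H hH using fun j => exists_comp_of_dependsOn (hG j)
  have hind' : IndepFun (fun w (s : Finset.range t) => i s w) (i t) ν :=
    (hind.indepFun_finset (Finset.range t) {t} (by simp) hi).comp
      (φ := id) (ψ := fun h : (({t} : Finset ℕ) → Fin m) => h ⟨t, Finset.mem_singleton_self t⟩)
      measurable_id (measurable_pi_apply _)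
  have hset : ∀ j, MeasurableSet {w | i t w = j} := fun j => hi t (measurableSet_singleton j)
  have hind_int : ∀ j, Integrable (Set.indicator {w | i t w = j} fun _ => (1 : ℝ)) ν := fun j =>
    (integrable_const 1).indicator (hset j)
  -- Splitting by the value of `i t` turns the integrand into a sum of products of independent
  -- factors.
  have hsplit : ∀ w, G (i t w) (fun s => i s w)
      = ∑ j, Set.indicator {w | i t w = j} (fun _ => (1 : ℝ)) w * G j (fun s => i s w) := by
    intro w
    rw [Finset.sum_eq_single (i t w)]
    · simp
    · intro j _ hj
      rw [Set.indicator_of_notMem (s := {w | i t w = j}) (fun h => hj (Eq.symm h)), zero_mul]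
    · simp
  have hmul : ∀ j, IndepFun (Set.indicator {w | i t w = j} fun _ => (1 : ℝ))
      (fun w => G j fun s => i s w) ν := by
    intro j
    have h := hind'.symm.comp (φ := fun a => Set.indicator {j} (fun _ => (1 : ℝ)) a) (ψ := H j)
      Measurable.of_discrete Measurable.of_discrete
    have e : (fun w => G j fun s => i s w) = H j ∘ fun w (s : Finset.range t) => i s w :=
      funext fun w => hH j _
    rw [e]
    exact h
  have hprod : ∀ j, Integrable (fun w => Set.indicator {w | i t w = j} (fun _ => (1 : ℝ)) w
      * G j (fun s => i s w)) ν := fun j =>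
    (hmul j).integrable_mul (hind_int j) (integrable_of_dependsOn hi (hG j))
  simp only [hsplit]
  rw [integral_finsetSum _ fun j _ => hprod j,
    integral_finsetSum _ fun j _ => (integrable_of_dependsOn hi (hG j)).const_mul _]
  refine Finset.sum_congr rfl fun j _ => ?_
  rw [(hmul j).integral_fun_mul_eq_mul_integral (hind_int j).aestronglyMeasurable
    (integrable_of_dependsOn hi (hG j)).aestronglyMeasurable, integral_const_mul,
    integral_indicator_const _ (hset j), hp, smul_eq_mul, mul_one]

end RandomIndices

/-! ### Mean square convergence of the iterates and of the ergodic mean -/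

theorem dependsOn_rpdgIter {n m : ℕ} (P : CompositeProblem n m) (q : RPDGParams m) (x0 : Eucl n)
    (t : ℕ) : DependsOn (fun i => rpdgIter P q x0 i t) (Finset.range t : Set ℕ) := by
  induction t with
  | zero => exact fun _ _ _ => rfl
  | succ t ih =>
    intro x y hxy
    have h1 : rpdgIter P q x0 x t = rpdgIter P q x0 y t :=
      ih fun s hs => hxy s (by simp at hs ⊢; omega)
    have h2 : x t = y t := hxy t (by simp)
    simp only [rpdgIter, h1, h2]

theorem DependsOn.comp_left {ι β γ : Type*} {α : ι → Type*} {F : (∀ i, α i) → β} {s : Set ι}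
    (hF : DependsOn F s) (φ : β → γ) : DependsOn (fun x => φ (F x)) s :=
  fun _ _ h => congrArg φ (hF h)

theorem dependsOn_rpdgMean {n m : ℕ} (P : CompositeProblem n m) (q : RPDGParams m) (θ : ℕ → ℝ)
    (x0 : Eucl n) (k : ℕ) :
    DependsOn (fun i => rpdgMean P q θ x0 i k) (Finset.range k : Set ℕ) := by
  intro x y hxy
  simp only [rpdgMean]
  congr 1
  refine Finset.sum_congr rfl fun t ht => ?_
  have h : rpdgIter P q x0 x t = rpdgIter P q x0 y t :=
    dependsOn_rpdgIter P q x0 t fun s hs => hxy s (by simp at hs ht ⊢; omega)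
  rw [h]

/-- Linear convergence of the iterates in mean square. -/
theorem integral_norm_rpdgIter_sub_sq_le {n m : ℕ} {f : Fin m → Eucl n → ℝ} {Lc : Fin m → ℝ}
    {x0 u : Eucl n} {p : Fin m → ℝ} {μ τ η α : ℝ}
    (hf : ∀ j, Differentiable ℝ (f j)) (hc : ∀ j, ConvexOn ℝ Set.univ (f j)) (hL0 : ∀ j, 0 ≤ Lc j)
    (hL : ∀ j x y, ‖gradient (f j) x - gradient (f j) y‖ ≤ Lc j * ‖x - y‖)
    (hLpos : 0 < ∑ j, Lc j)
    (hu : ∑ i, gradient (f i) u + μ • (u - x0) = 0)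
    (hμ : 0 < μ) (hτ : 0 ≤ τ) (hη : 0 < η) (hα0 : 0 ≤ α) (hα1 : α ≤ 1)
    (hp : ∀ j, 1 / (2 * m) ≤ p j) (hpsum : ∑ j, p j = 1)
    (hpL : ∀ j, Lc j ≤ 2 * (∑ j, Lc j) * p j)
    (hτη : 8 * (∑ j, Lc j) ≤ τ * η) (hηα : η / 2 ≤ α * (μ + η / 2))
    (hτα : (1 - α) * (1 + τ) ≤ 1 / (2 * m))
    {Ω : Type*} [MeasurableSpace Ω] {ν : Measure Ω} [IsProbabilityMeasure ν]
    {i : ℕ → Ω → Fin m} (hi : ∀ t, Measurable (i t)) (hind : iIndepFun i ν)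
    (hip : ∀ t j, ν.real {w | i t w = j} = p j) (t : ℕ) :
    (μ + η / 2) * ∫ w, ‖(rpdgIter (perturbedProblem f x0 μ) (constParams p τ η α) x0
        (fun s => i s w) t).x - u‖ ^ 2 ∂ν ≤
      α ^ t * ((μ + η / 2 + m * (1 + τ) * ∑ i, Lc i) * ‖x0 - u‖ ^ 2) := by
  have hp0 : ∀ j, 0 < p j := fun j =>
    lt_of_lt_of_le (by have : (0 : ℝ) < m := by exact_mod_cast j.pos
                       positivity) (hp j)
  set P := perturbedProblem f x0 μ with hP
  set q := constParams p τ η α with hq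
  have hdep : ∀ t, DependsOn (fun i => lyapunov f p μ τ η u (rpdgIter P q x0 i t))
      (Finset.range t : Set ℕ) := fun t => (dependsOn_rpdgIter P q x0 t).comp_left _
  have hE : ∀ t, ∫ w, lyapunov f p μ τ η u (rpdgIter P q x0 (fun s => i s w) t) ∂ν ≤
      α ^ t * ((μ + η / 2 + m * (1 + τ) * ∑ i, Lc i) * ‖x0 - u‖ ^ 2) := by
    intro t
    induction t with
    | zero =>
      simp only [rpdgIter, integral_const, probReal_univ, one_smul, pow_zero, one_mul]
      exact lyapunov_start_le hf hL0 hL hτ hp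
    | succ t ih =>
      have hG : ∀ j, DependsOn (fun i => lyapunov f p μ τ η u
          (rpdgStep P q (t + 1) j (rpdgIter P q x0 i t))) (Finset.range t : Set ℕ) := fun j =>
        (dependsOn_rpdgIter P q x0 t).comp_left
          fun s => lyapunov f p μ τ η u (rpdgStep P q (t + 1) j s)
      calc ∫ w, lyapunov f p μ τ η u (rpdgIter P q x0 (fun s => i s w) (t + 1)) ∂ν
          = ∫ w, ∑ j, p j * lyapunov f p μ τ η u
              (rpdgStep P q (t + 1) j (rpdgIter P q x0 (fun s => i s w) t)) ∂ν :=
            integral_next_index hi hind (hip t) hG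
        _ ≤ ∫ w, α * lyapunov f p μ τ η u (rpdgIter P q x0 (fun s => i s w) t) ∂ν := by
            refine integral_mono
              (integrable_finsetSum _ fun j _ => (integrable_of_dependsOn hi (hG j)).const_mul _)
              ((integrable_of_dependsOn hi (hdep t)).const_mul _) fun w => ?_
            exact sum_lyapunov_rpdgStep_le hf hc hL0 hL hu hμ hτ hη hα0 hα1 hp0 hpsum hpL hτη hηα
              (fun j => hτα.trans (hp j)) (t + 1) (rpdgIter_consistent f x0 μ q _ t)
        _ = α * ∫ w, lyapunov f p μ τ η u (rpdgIter P q x0 (fun s => i s w) t) ∂ν :=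
            integral_const_mul _ _
        _ ≤ α * (α ^ t * ((μ + η / 2 + m * (1 + τ) * ∑ i, Lc i) * ‖x0 - u‖ ^ 2)) := by gcongr
        _ = _ := by ring
  refine le_trans ?_ (hE t)
  rw [← integral_const_mul]
  refine integral_mono ((integrable_of_dependsOn hi ((dependsOn_rpdgIter P q x0 t).comp_left
    fun s => ‖s.x - u‖ ^ 2)).const_mul _) (integrable_of_dependsOn hi (hdep t)) fun w => ?_
  exact lyapunov_ge hf hc hL0 hL hLpos hτ hη hp0 hpsum hpL hτη (rpdgIter_consistent f x0 μ q _ t)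

/-- Mean square distance of the iterates for the non-uniform parameter setting. -/
theorem integral_norm_nonuniform_sub_sq_le {n m : ℕ} {f : Fin m → Eucl n → ℝ} {Lc : Fin m → ℝ}
    {x0 u : Eucl n} {δ C : ℝ}
    (hf : ∀ j, Differentiable ℝ (f j)) (hc : ∀ j, ConvexOn ℝ Set.univ (f j)) (hL0 : ∀ j, 0 ≤ Lc j)
    (hL : ∀ j x y, ‖gradient (f j) x - gradient (f j) y‖ ≤ Lc j * ‖x - y‖)
    (hLpos : 0 < ∑ j, Lc j) (hm : 1 ≤ m)
    (hu : ∑ i, gradient (f i) u + δ • (u - x0) = 0) (hδ : 0 < δ) (hC : 0 < C)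
    (hδC : 8 * (∑ j, Lc j) ≤ δ * C)
    {Ω : Type*} [MeasurableSpace Ω] {ν : Measure Ω} [IsProbabilityMeasure ν]
    {i : ℕ → Ω → Fin m} (hi : ∀ t, Measurable (i t)) (hind : iIndepFun i ν)
    (hip : ∀ t j, ν.real {w | i t w = j} = (nonuniformParams Lc δ C).p j) (t : ℕ) :
    ∫ w, ‖(rpdgIter (perturbedProblem f x0 δ) (nonuniformParams Lc δ C) x0
        (fun s => i s w) t).x - u‖ ^ 2 ∂ν ≤
      rpdgAlpha m C ^ t * ((1 + 2 * (∑ j, Lc j) / δ) * ‖x0 - u‖ ^ 2) := by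
  set L := ∑ j, Lc j with hLdef
  have hm' : (1 : ℝ) ≤ m := by exact_mod_cast hm
  have hm0 : (0 : ℝ) < m := by linarith
  set S := √(((m : ℝ) - 1) ^ 2 + 4 * m * C) with hS
  have hS2 : S ^ 2 = ((m : ℝ) - 1) ^ 2 + 4 * m * C := Real.sq_sqrt (by positivity)
  have hSm : (m : ℝ) - 1 ≤ S := Real.le_sqrt_of_sq_le (by nlinarith [mul_pos hm0 hC])
  have hS0 : 0 < S := Real.sqrt_pos.2 (by positivity)
  set N := ((m : ℝ) + 1) + S with hN
  have hN2 : 2 ≤ N := by linarith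
  set τ := (S - (m - 1)) / (2 * m) with hτdef
  set η := (δ * S + δ * (m - 1)) / 2 with hηdef
  set α := rpdgAlpha m C with hα
  have hαN : α = 1 - 1 / N := rfl
  have hη' : δ + η / 2 = δ * (N + 2) / 4 := by rw [hηdef, hN]; ring
  have hτN : 1 + τ = N / (2 * m) := by rw [hτdef, hN]; field_simp; ring
  have hη : 0 < η := by
    have : 0 ≤ δ * (m - 1) := mul_nonneg hδ.le (by linarith)
    positivity
  have hN0 : 0 < N := by linarith
  have hN1 : 1 / N ≤ 1 := by rw [div_le_one hN0]; linarith
  have hτη : τ * η = δ * C := by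
    have : τ * η = δ * (S ^ 2 - ((m : ℝ) - 1) ^ 2) / (4 * m) := by
      rw [hτdef, hηdef]; field_simp; ring
    rw [this, hS2]; field_simp; ring
  have key := integral_norm_rpdgIter_sub_sq_le (x0 := x0) (u := u)
    (p := fun i => 1 / (2 * m) + Lc i / (2 * L)) (μ := δ) (τ := τ) (η := η) (α := α)
    hf hc hL0 hL hLpos hu hδ (div_nonneg (by linarith) (by positivity)) hη
    (by rw [hαN]; linarith) (by rw [hαN]; linarith [one_div_pos.2 hN0])
    (fun j => by have := div_nonneg (hL0 j) (by positivity : 0 ≤ 2 * L); linarith)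
    (by
      rw [Finset.sum_add_distrib, ← Finset.sum_div, ← Finset.sum_div, ← hLdef]
      simp only [Finset.sum_const, Finset.card_univ, Fintype.card_fin, nsmul_eq_mul]
      field_simp
      norm_num)
    (fun j => by
      have h1 : 2 * L * (1 / (2 * m) + Lc j / (2 * L)) = L / m + Lc j := by field_simp
      rw [h1]
      linarith [div_pos hLpos hm0])
    (by rw [hτη]; exact hδC)
    (by
      rw [hη', hαN]
      have h1 : (1 - 1 / N) * (δ * (N + 2) / 4) - η / 2 = δ * (3 * N - 2) / (4 * N) := by
        rw [hηdef, show S = N - (m + 1) by rw [hN]; ring]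
        field_simp
        ring
      have h2 : 0 ≤ δ * (3 * N - 2) / (4 * N) :=
        div_nonneg (mul_nonneg hδ.le (by linarith)) (by positivity)
      linarith)
    (by rw [hτN, hαN]; apply le_of_eq; field_simp; ring)
    hi hind hip t
  have hconst : δ + η / 2 + m * (1 + τ) * L ≤ (δ + η / 2) * (1 + 2 * L / δ) := by
    rw [hη', hτN]
    have h1 : δ * (N + 2) / 4 * (1 + 2 * L / δ) - (δ * (N + 2) / 4 + m * (N / (2 * m)) * L) = L := by
      field_simp
      ring
    linarith
  have hpos : 0 < δ + η / 2 := by positivity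
  have hα0 : 0 ≤ α := by rw [hαN]; linarith
  refine le_of_mul_le_mul_left (key.trans ?_) hpos
  calc α ^ t * ((δ + η / 2 + m * (1 + τ) * L) * ‖x0 - u‖ ^ 2)
      ≤ α ^ t * ((δ + η / 2) * (1 + 2 * L / δ) * ‖x0 - u‖ ^ 2) := by gcongr
    _ = _ := by ring

/-- Jensen's inequality, with the total weight bounded below by its last term only. -/
theorem norm_weighted_mean_sub_sq_le {E : Type*} [NormedAddCommGroup E] [InnerProductSpace ℝ E]
    {k : ℕ} (hk : 1 ≤ k) {θ : ℕ → ℝ} (hθ : ∀ t, 0 < θ t) (x : ℕ → E) (u : E) :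
    ‖(∑ t ∈ Finset.Icc 1 k, θ t)⁻¹ • ∑ t ∈ Finset.Icc 1 k, θ t • x t - u‖ ^ 2 ≤
      (θ k)⁻¹ * ∑ t ∈ Finset.Icc 1 k, θ t * ‖x t - u‖ ^ 2 := by
  set W := ∑ t ∈ Finset.Icc 1 k, θ t with hW
  have hkW : θ k ≤ W :=
    Finset.single_le_sum (fun t _ => (hθ t).le) (Finset.mem_Icc.2 ⟨hk, le_rfl⟩)
  have hW0 : 0 < W := (hθ k).trans_le hkW
  have e : W⁻¹ • ∑ t ∈ Finset.Icc 1 k, θ t • x t - u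
      = ∑ t ∈ Finset.Icc 1 k, (W⁻¹ * θ t) • (x t - u) := by
    simp only [smul_sub, Finset.sum_sub_distrib, mul_smul]
    rw [← Finset.smul_sum, ← Finset.smul_sum, ← Finset.sum_smul, ← hW, inv_smul_smul₀ hW0.ne']
  have hconv : ConvexOn ℝ Set.univ fun y : E => ‖y‖ ^ 2 :=
    convexOn_univ_norm.pow (fun _ _ => norm_nonneg _) 2
  have h := hconv.map_sum_le (t := Finset.Icc 1 k) (w := fun t => W⁻¹ * θ t)
    (p := fun t => x t - u) (fun t _ => by have := hθ t; positivity)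
    (by rw [← Finset.mul_sum, ← hW, inv_mul_cancel₀ hW0.ne']) (fun _ _ => Set.mem_univ _)
  rw [e]
  refine h.trans ?_
  simp only [smul_eq_mul, mul_assoc]
  rw [← Finset.mul_sum]
  have h0 : 0 ≤ ∑ t ∈ Finset.Icc 1 k, θ t * ‖x t - u‖ ^ 2 :=
    Finset.sum_nonneg fun t _ => mul_nonneg (hθ t).le (by positivity)
  gcongr
  exact hθ k

theorem rpdgAlpha_mem {m : ℕ} (hm : 1 ≤ m) (C : ℝ) : 0 < rpdgAlpha m C ∧ rpdgAlpha m C < 1 := by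
  have hm' : (1 : ℝ) ≤ m := by exact_mod_cast hm
  have hS := Real.sqrt_nonneg (((m : ℝ) - 1) ^ 2 + 4 * m * C)
  unfold rpdgAlpha
  constructor
  · rw [sub_pos, div_lt_one] <;> linarith
  · have : 0 < 1 / (((m : ℝ) + 1) + √(((m : ℝ) - 1) ^ 2 + 4 * m * C)) :=
      one_div_pos.2 (by linarith)
    linarith

/-- Mean square distance of the ergodic mean. -/
theorem integral_norm_rpdgMean_sub_sq_le {n m : ℕ} {f : Fin m → Eucl n → ℝ} {Lc : Fin m → ℝ}
    {x0 u : Eucl n} {δ C : ℝ}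
    (hf : ∀ j, Differentiable ℝ (f j)) (hc : ∀ j, ConvexOn ℝ Set.univ (f j)) (hL0 : ∀ j, 0 ≤ Lc j)
    (hL : ∀ j x y, ‖gradient (f j) x - gradient (f j) y‖ ≤ Lc j * ‖x - y‖)
    (hLpos : 0 < ∑ j, Lc j) (hm : 1 ≤ m)
    (hu : ∑ i, gradient (f i) u + δ • (u - x0) = 0) (hδ : 0 < δ) (hC : 0 < C)
    (hδC : 8 * (∑ j, Lc j) ≤ δ * C)
    {Ω : Type*} [MeasurableSpace Ω] {ν : Measure Ω} [IsProbabilityMeasure ν]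
    {i : ℕ → Ω → Fin m} (hi : ∀ t, Measurable (i t)) (hind : iIndepFun i ν)
    (hip : ∀ t j, ν.real {w | i t w = j} = (nonuniformParams Lc δ C).p j) {k : ℕ} (hk : 1 ≤ k) :
    ∫ w, ‖rpdgMean (perturbedProblem f x0 δ) (nonuniformParams Lc δ C) (nonuniformWeights m C) x0
        (fun s => i s w) k - u‖ ^ 2 ∂ν ≤
      k * rpdgAlpha m C ^ k * ((1 + 2 * (∑ j, Lc j) / δ) * ‖x0 - u‖ ^ 2) := by
  set P := perturbedProblem f x0 δ
  set q := nonuniformParams Lc δ C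
  set A := (1 + 2 * (∑ j, Lc j) / δ) * ‖x0 - u‖ ^ 2
  have hα := (rpdgAlpha_mem hm C).1
  set α := rpdgAlpha m C with hαdef
  have hθ : ∀ t, nonuniformWeights m C t = (α ^ t)⁻¹ := fun t => one_div _
  have hint : ∀ t, Integrable (fun w => ‖(rpdgIter P q x0 (fun s => i s w) t).x - u‖ ^ 2) ν :=
    fun t => integrable_of_dependsOn hi
      ((dependsOn_rpdgIter P q x0 t).comp_left fun s => ‖s.x - u‖ ^ 2)
  calc ∫ w, ‖rpdgMean P q (nonuniformWeights m C) x0 (fun s => i s w) k - u‖ ^ 2 ∂ν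
      ≤ ∫ w, α ^ k * ∑ t ∈ Finset.Icc 1 k,
          (α ^ t)⁻¹ * ‖(rpdgIter P q x0 (fun s => i s w) t).x - u‖ ^ 2 ∂ν := by
        refine integral_mono (integrable_of_dependsOn hi ((dependsOn_rpdgMean P q _ x0 k).comp_left
          fun y => ‖y - u‖ ^ 2)) ((integrable_finsetSum _ fun t _ =>
            (hint t).const_mul _).const_mul _) fun w => ?_
        have h := norm_weighted_mean_sub_sq_le hk (θ := nonuniformWeights m C)
          (fun t => by rw [hθ]; positivity) (fun t => (rpdgIter P q x0 (fun s => i s w) t).x) u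
        simp only [hθ, inv_inv] at h
        simp only [rpdgMean, hθ]
        exact h
    _ = α ^ k * ∑ t ∈ Finset.Icc 1 k,
          (α ^ t)⁻¹ * ∫ w, ‖(rpdgIter P q x0 (fun s => i s w) t).x - u‖ ^ 2 ∂ν := by
        rw [integral_const_mul, integral_finsetSum _ fun t _ => (hint t).const_mul _]
        simp only [integral_const_mul]
    -- The weight `α^{-t}` exactly offsets the decay `α^t`, so every term is bounded by the same
    -- `A`; hence the factor `k`.
    _ ≤ α ^ k * ∑ t ∈ Finset.Icc 1 k, A := by
        gcongr with t ht
        rw [inv_mul_le_iff₀ (by positivity)]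
        exact integral_norm_nonuniform_sub_sq_le hf hc hL0 hL hLpos hm hu hδ hC hδC hi hind hip t
    _ = k * α ^ k * A := by
        simp only [Finset.sum_const, Nat.card_Icc, add_tsub_cancel_right, nsmul_eq_mul]
        ring

/-! ### From the perturbed problem to the relative accuracy -/

/-- The sum is bounded below by its minimum, so the quadratic term makes the perturbed objective
coercive. -/
theorem exists_isMin_perturbed {n m : ℕ} {f : Fin m → Eucl n → ℝ} (x0 : Eucl n) {δ : ℝ}
    (hf : ∀ j, Differentiable ℝ (f j)) (hmin : (minimizers fun x => ∑ j, f j x).Nonempty)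
    (hδ : 0 < δ) :
    ∃ u, (∀ x, ∑ j, f j u + δ / 2 * ‖u - x0‖ ^ 2 ≤ ∑ j, f j x + δ / 2 * ‖x - x0‖ ^ 2) ∧
      ∑ j, gradient (f j) u + δ • (u - x0) = 0 := by
  obtain ⟨v, hv⟩ := hmin
  have hcont : Continuous fun x => ∑ j, f j x + δ / 2 * ‖x - x0‖ ^ 2 := by
    have := fun j => (hf j).continuous
    fun_prop
  have htend : Filter.Tendsto (fun x => ∑ j, f j x + δ / 2 * ‖x - x0‖ ^ 2)
      (Filter.cocompact (Eucl n)) Filter.atTop := by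
    have h1 : Filter.Tendsto (fun x : Eucl n => ‖x - x0‖ ^ 2)
        (Filter.cocompact (Eucl n)) Filter.atTop := by
      simp only [← dist_eq_norm]
      exact (Filter.tendsto_pow_atTop two_ne_zero).comp (tendsto_dist_right_cocompact_atTop x0)
    refine Filter.tendsto_atTop_mono (fun x => ?_)
      (Filter.tendsto_atTop_add_const_left _ (∑ j, f j v)
        (h1.const_mul_atTop (half_pos hδ)))
    exact add_le_add_left (hv x) _
  obtain ⟨u, hu⟩ := hcont.exists_forall_le htend
  refine ⟨u, hu, ?_⟩
  have hsum : HasFDerivAt (fun x => ∑ j, f j x) (∑ j, fderiv ℝ (f j) u) u :=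
    HasFDerivAt.fun_sum fun j _ => (hf j u).hasFDerivAt
  have hq := (hasGradientAt_half_norm_sub_sq x0 u).hasFDerivAt.const_mul δ
  have hmin' : IsLocalMin (fun x => ∑ j, f j x + δ * (‖x - x0‖ ^ 2 / 2)) u :=
    Filter.Eventually.of_forall fun x => by
      have := hu x
      simp only
      linarith
  have h0 := hmin'.hasFDerivAt_eq_zero (hsum.add hq)
  apply (InnerProductSpace.toDual ℝ (Eucl n)).injective
  rw [map_add, map_sum, map_zero, ← h0]
  congr 1
  · exact Finset.sum_congr rfl fun j _ => toDual_gradient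
  · simp

/-- Suboptimality of the original objective in terms of the distance to the minimizer of the
perturbed objective. -/
theorem sub_iInf_le_of_perturbed {n m : ℕ} {f : Fin m → Eucl n → ℝ} {Lc : Fin m → ℝ}
    {x0 u : Eucl n} {δ : ℝ} (hf : ∀ j, Differentiable ℝ (f j))
    (hL : ∀ j x y, ‖gradient (f j) x - gradient (f j) y‖ ≤ Lc j * ‖x - y‖)
    (hmin : (minimizers fun x => ∑ j, f j x).Nonempty) (hδ : 0 < δ)
    (hu : ∀ x, ∑ j, f j u + δ / 2 * ‖u - x0‖ ^ 2 ≤ ∑ j, f j x + δ / 2 * ‖x - x0‖ ^ 2)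
    (hgrad : ∑ j, gradient (f j) u + δ • (u - x0) = 0) :
    ‖x0 - u‖ ≤ Metric.infDist x0 (minimizers fun x => ∑ j, f j x) ∧
    ∀ x, ∑ j, f j x - ⨅ x, ∑ j, f j x ≤ ((∑ j, Lc j) + δ) / 2 * ‖x - u‖ ^ 2
      + δ / 2 * Metric.infDist x0 (minimizers fun x => ∑ j, f j x) ^ 2 := by
  set F : Eucl n → ℝ := fun x => ∑ j, f j x with hF
  have hclosed : IsClosed (minimizers F) := by
    have hFc : Continuous F := by
      have := fun j => (hf j).continuous
      fun_prop
    have e : minimizers F = ⋂ x, {u | F u ≤ F x} := by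
      ext u
      simp [minimizers]
    rw [e]
    exact isClosed_iInter fun x => isClosed_le hFc continuous_const
  obtain ⟨v, hv, hd⟩ := hclosed.exists_infDist_eq_dist hmin x0
  have hinf : ⨅ x, F x = F v :=
    le_antisymm (ciInf_le ⟨F v, by rintro _ ⟨x, rfl⟩; exact hv x⟩ v) (le_ciInf hv)
  rw [hd, dist_eq_norm, hinf]
  have huv : F u + δ / 2 * ‖u - x0‖ ^ 2 ≤ F v + δ / 2 * ‖v - x0‖ ^ 2 := hu v
  rw [norm_sub_rev v x0, norm_sub_rev u x0] at huv
  constructor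
  · have h1 : δ / 2 * ‖x0 - u‖ ^ 2 ≤ δ / 2 * ‖x0 - v‖ ^ 2 := by linarith [hv u]
    exact le_of_sq_le_sq (le_of_mul_le_mul_left h1 (half_pos hδ)) (norm_nonneg _)
  · intro x
    have hB : ∑ j, bregman (f j) x u ≤ (∑ j, Lc j) / 2 * ‖x - u‖ ^ 2 := by
      rw [Finset.sum_div, Finset.sum_mul]
      exact Finset.sum_le_sum fun j _ => bregman_le (hf j) (hL j) x u
    have hBe : ∑ j, bregman (f j) x u = F x - F u + δ * inner ℝ (u - x0) (x - u) := by
      simp only [bregman, Finset.sum_sub_distrib, ← sum_inner]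
      rw [eq_neg_of_add_eq_zero_left hgrad, inner_neg_left, real_inner_smul_left]
      ring
    -- This trades the linear term for squares. Dropping `-δ/2 ‖x - x0‖²` leaves `δ/2 ‖x0 - u‖²`,
    -- which `huv` absorbs.
    have hsq : ‖x - x0‖ ^ 2 = ‖x - u‖ ^ 2 + 2 * inner ℝ (u - x0) (x - u) + ‖x0 - u‖ ^ 2 := by
      rw [show x - x0 = (x - u) + (u - x0) by abel, norm_add_sq_real, real_inner_comm,
        norm_sub_rev x0 u]
    have h0 : 0 ≤ δ / 2 * ‖x - x0‖ ^ 2 := by positivity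
    rw [hsq] at h0
    change F x - F v ≤ _
    linarith

/-- Both accuracy guarantees after a number of iterations that makes the contraction factor
small. -/
theorem rpdgRelAccuracy_bounds {n m : ℕ} {f : Fin m → Eucl n → ℝ} {Lc : Fin m → ℝ}
    {x0 : Eucl n} {ε δ C lam : ℝ}
    (hf : ∀ j, Differentiable ℝ (f j)) (hc : ∀ j, ConvexOn ℝ Set.univ (f j)) (hL0 : ∀ j, 0 ≤ Lc j)
    (hL : ∀ j x y, ‖gradient (f j) x - gradient (f j) y‖ ≤ Lc j * ‖x - y‖)
    (hmin : (minimizers fun x => ∑ j, f j x).Nonempty)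
    (hLpos : 0 < ∑ j, Lc j) (hm : 1 ≤ m) (hε : 0 < ε) (hδ : δ = (∑ j, Lc j) * ε / 2) (hC : 0 < C)
    (hδC : 8 * (∑ j, Lc j) ≤ δ * C)
    {Ω : Type*} [MeasurableSpace Ω] {ν : Measure Ω} [IsProbabilityMeasure ν]
    {i : ℕ → Ω → Fin m} (hi : ∀ t, Measurable (i t)) (hind : iIndepFun i ν)
    (hip : ∀ t j, ν.real {w | i t w = j} = (nonuniformParams Lc δ C).p j) {k : ℕ} (hk : 1 ≤ k)
    (hlam0 : 0 < lam) (hlam1 : lam ≤ 1)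
    (hkα : (1 + 2 / ε) * (1 + 4 / ε) * (k * rpdgAlpha m C ^ k) ≤ lam) :
    (Integrable (fun w => rpdgRelAccuracy f Lc x0 δ C (fun t => i t w) k) ν ∧
      ∫ w, rpdgRelAccuracy f Lc x0 δ C (fun t => i t w) k ∂ν ≤ ε) ∧
    ν.real {w | ε < rpdgRelAccuracy f Lc x0 δ C (fun t => i t w) k} ≤ lam := by
  set L := ∑ j, Lc j with hLdef
  have hδ0 : 0 < δ := by rw [hδ]; positivity
  obtain ⟨u, hu, hgrad⟩ := exists_isMin_perturbed x0 hf hmin hδ0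
  obtain ⟨hD, hgap⟩ := sub_iInf_le_of_perturbed hf hL hmin hδ0 hu hgrad
  set D := Metric.infDist x0 (minimizers fun x => ∑ j, f j x) with hDdef
  set xm : (ℕ → Fin m) → Eucl n := fun i => rpdgMean (perturbedProblem f x0 δ)
    (nonuniformParams Lc δ C) (nonuniformWeights m C) x0 i k with hxm
  have hdep : DependsOn xm (Finset.range k : Set ℕ) := dependsOn_rpdgMean _ _ _ _ _
  set Z : Ω → ℝ := fun w => (L + δ) * ‖xm (fun t => i t w) - u‖ ^ 2 with hZ
  have hZint : Integrable Z ν :=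
    (integrable_of_dependsOn hi (hdep.comp_left fun y => ‖y - u‖ ^ 2)).const_mul _
  have hα := (rpdgAlpha_mem hm C).1
  have hZE : ∫ w, Z w ∂ν ≤ lam * δ * D ^ 2 := by
    have h1 := integral_norm_rpdgMean_sub_sq_le (x0 := x0) hf hc hL0 hL hLpos hm hgrad hδ0 hC hδC
      hi hind hip hk
    have e1 : 2 * L / δ = 4 / ε := by rw [hδ]; field_simp; norm_num
    have e2 : L + δ = δ * (1 + 2 / ε) := by rw [hδ]; field_simp; ring
    rw [← hLdef, e1] at h1
    calc ∫ w, Z w ∂ν = (L + δ) * ∫ w, ‖xm (fun t => i t w) - u‖ ^ 2 ∂ν := integral_const_mul _ _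
      _ ≤ (L + δ) * (k * rpdgAlpha m C ^ k * ((1 + 4 / ε) * ‖x0 - u‖ ^ 2)) := by gcongr
      _ ≤ (L + δ) * (k * rpdgAlpha m C ^ k * ((1 + 4 / ε) * D ^ 2)) := by gcongr
      _ = (1 + 2 / ε) * (1 + 4 / ε) * (k * rpdgAlpha m C ^ k) * (δ * D ^ 2) := by rw [e2]; ring
      _ ≤ lam * (δ * D ^ 2) := by gcongr
      _ = _ := by ring
  have hden : 0 < L * (1 + D ^ 2) := by positivity
  have hR : ∀ w, rpdgRelAccuracy f Lc x0 δ C (fun t => i t w) k ≤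
      (Z w + δ * D ^ 2) / (L * (1 + D ^ 2)) := by
    intro w
    have h := hgap (xm fun t => i t w)
    simp only [rpdgRelAccuracy, relAccuracy, ← hDdef, ← hLdef]
    gcongr
    simp only [hZ]
    linarith
  have hRint : Integrable (fun w => rpdgRelAccuracy f Lc x0 δ C (fun t => i t w) k) ν :=
    integrable_of_dependsOn hi
      (hdep.comp_left fun y => relAccuracy (fun x => ∑ j, f j x) (∑ j, Lc j) x0 y)
  -- The accuracy budget: the bias takes `δ D²`, which leaves `2δ + δ D²` for `Z`. Its mean is at
  -- most `lam * δ * D²`, enough both for the expectation and for Markov's inequality at that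
  -- threshold.
  have hεδ : ε * (L * (1 + D ^ 2)) = 2 * δ + 2 * δ * D ^ 2 := by rw [hδ]; ring
  have hδD : 0 ≤ δ * D ^ 2 := by positivity
  refine ⟨⟨hRint, ?_⟩, ?_⟩
  · calc ∫ w, rpdgRelAccuracy f Lc x0 δ C (fun t => i t w) k ∂ν
        ≤ ∫ w, (Z w + δ * D ^ 2) / (L * (1 + D ^ 2)) ∂ν :=
          integral_mono hRint ((hZint.add (integrable_const _)).div_const _) hR
      _ = (∫ w, Z w ∂ν + δ * D ^ 2) / (L * (1 + D ^ 2)) := by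
          rw [integral_div, integral_add hZint (integrable_const _)]
          simp
      _ ≤ ε := by
          rw [div_le_iff₀ hden, hεδ]
          nlinarith
  · have hsub : {w | ε < rpdgRelAccuracy f Lc x0 δ C (fun t => i t w) k} ⊆
        {w | 2 * δ + δ * D ^ 2 ≤ Z w} := by
      intro w hw
      have h : ε < (Z w + δ * D ^ 2) / (L * (1 + D ^ 2)) := lt_of_lt_of_le hw (hR w)
      rw [lt_div_iff₀ hden, hεδ] at h
      change _ ≤ Z w
      linarith
    have hmarkov := mul_meas_ge_le_integral_of_nonneg (μ := ν) (f := Z)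
      (Filter.Eventually.of_forall fun w => by simp only [hZ, Pi.zero_apply]; positivity) hZint
      (2 * δ + δ * D ^ 2)
    have hmono : ν.real {w | ε < rpdgRelAccuracy f Lc x0 δ C (fun t => i t w) k} ≤
      ν.real {w | 2 * δ + δ * D ^ 2 ≤ Z w} := measureReal_mono hsub
    have hc0 : 0 < 2 * δ + δ * D ^ 2 := by positivity
    refine hmono.trans (le_of_mul_le_mul_left ((hmarkov.trans hZE).trans ?_) hc0)
    nlinarith

/-! ### Iteration counts -/

/-- Half of the exponential decay absorbs the factor `k`; the other half is kept. -/
theorem one_sub_inv_pow_mul_le {N : ℝ} (hN : 1 ≤ N) (k : ℕ) :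
    k * (1 - 1 / N) ^ k ≤ 2 * N * Real.exp (-(k / (2 * N))) := by
  have hN0 : 0 < N := by linarith
  have h1 : (1 - 1 / N) ^ k ≤ Real.exp (-(k / (2 * N))) * Real.exp (-(k / (2 * N))) := by
    have h2 : (0 : ℝ) ≤ 1 - 1 / N := by rw [sub_nonneg, div_le_one hN0]; exact hN
    have h3 : 1 - 1 / N ≤ Real.exp (-(1 / N)) := by linarith [Real.add_one_le_exp (-(1 / N))]
    calc (1 - 1 / N) ^ k ≤ Real.exp (-(1 / N)) ^ k := by gcongr
      _ = Real.exp (-(k / (2 * N))) * Real.exp (-(k / (2 * N))) := by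
        rw [← Real.exp_nat_mul, ← Real.exp_add]
        congr 1
        field_simp
        ring
  have h4 : (k : ℝ) * Real.exp (-(k / (2 * N))) ≤ 2 * N := by
    have h5 : (k : ℝ) / (2 * N) ≤ Real.exp (k / (2 * N)) := by
      linarith [Real.add_one_le_exp ((k : ℝ) / (2 * N))]
    rw [Real.exp_neg, ← div_eq_mul_inv, div_le_iff₀ (Real.exp_pos _)]
    rw [div_le_iff₀ (by positivity)] at h5
    linarith
  calc k * (1 - 1 / N) ^ k
      ≤ k * (Real.exp (-(k / (2 * N))) * Real.exp (-(k / (2 * N)))) := by gcongr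
    _ = k * Real.exp (-(k / (2 * N))) * Real.exp (-(k / (2 * N))) := by ring
    _ ≤ _ := by gcongr

/-- The number of iterations that makes the contraction factor of the ergodic mean small. -/
theorem contraction_le_of_iterations {m : ℕ} (hm : 1 ≤ m) {ε C lam : ℝ} (hε : 0 < ε)
    (hC : 0 < C) (hC' : C ≤ 16 / ε + 8) (hlam0 : 0 < lam) (hlam1 : lam ≤ 1) {k : ℕ}
    (hk : 176 * ((m + √(m / ε)) * Real.log (m * (2 + 1 / ε) / lam)) ≤ k) :
    1 ≤ k ∧ (1 + 2 / ε) * (1 + 4 / ε) * (k * rpdgAlpha m C ^ k) ≤ lam := by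
  have hm' : (1 : ℝ) ≤ m := by exact_mod_cast hm
  set r := 1 / ε with hr
  have hr0 : 0 < r := one_div_pos.2 hε
  have e2 : 2 / ε = 2 * r := by rw [hr]; ring
  have e4 : 4 / ε = 4 * r := by rw [hr]; ring
  have e16 : 16 / ε = 16 * r := by rw [hr]; ring
  have em : m / ε = m * r := by rw [hr]; ring
  rw [e2, e4]
  rw [e16] at hC'
  rw [em] at hk
  set Q := (m : ℝ) * (2 + r) with hQ
  set s := √((m : ℝ) * r) with hs
  have hs0 : 0 < s := Real.sqrt_pos.2 (by positivity)
  have hs2 : s ^ 2 = m * r := Real.sq_sqrt (by positivity)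
  have hQr : 2 + r ≤ Q := by rw [hQ]; nlinarith
  have hQ2 : 2 ≤ Q := by linarith
  set ℓ := Real.log (Q / lam) with hℓ
  have hQlam : Q ≤ Q / lam := by rw [le_div_iff₀ hlam0]; nlinarith
  have hℓ0 : 0 < ℓ := Real.log_pos (by linarith)
  have hk1 : 1 ≤ k := by
    have : (0 : ℝ) < k := lt_of_lt_of_le (by positivity) hk
    exact_mod_cast this
  refine ⟨hk1, ?_⟩
  set N := ((m : ℝ) + 1) + √(((m : ℝ) - 1) ^ 2 + 4 * m * C) with hN
  have hN1 : 1 ≤ N := by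
    have := Real.sqrt_nonneg (((m : ℝ) - 1) ^ 2 + 4 * m * C)
    linarith
  have hNs : N ≤ 8 * (m + s) := by
    have h1 : √(((m : ℝ) - 1) ^ 2 + 4 * m * C) ≤ 6 * m + 8 * s := by
      apply Real.sqrt_le_iff.2 ⟨by positivity, ?_⟩
      have h2 : 4 * m * C ≤ 64 * s ^ 2 + 32 * m := by rw [hs2]; nlinarith
      nlinarith [mul_pos (by linarith : (0 : ℝ) < m) hs0]
    linarith
  have hsQ : m + s ≤ 2 * Q := by
    have h1 : s ≤ m + r := Real.sqrt_le_iff.2 ⟨by positivity, by nlinarith⟩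
    have h2 : (m : ℝ) + r ≤ Q - m := by rw [hQ]; nlinarith
    linarith
  have hN0 : 0 < N := by linarith
  -- Here `176 = 2 · 8 · 11`, from the exponent `k/(2N)`, the bound `N ≤ 8(m + s)` and the power 11.
  -- The prefactors amount to `2^8 Q^3`, and `Q ≥ 2` makes the remaining `Q^8` suffice.
  have hexp : Real.exp (-(k / (2 * N))) ≤ lam / Q ^ 11 := by
    have h1 : 11 * ℓ ≤ k / (2 * N) := by
      rw [le_div_iff₀ (by positivity)]
      refine le_trans ?_ hk
      nlinarith [mul_le_mul_of_nonneg_right hNs hℓ0.le]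
    have h2 : Real.exp (-(11 * ℓ)) = (lam / Q) ^ 11 := by
      rw [Real.exp_neg, show (11 : ℝ) * ℓ = (11 : ℕ) * ℓ by norm_num, Real.exp_nat_mul, hℓ,
        Real.exp_log (by positivity), ← inv_pow, inv_div]
    calc Real.exp (-(k / (2 * N))) ≤ Real.exp (-(11 * ℓ)) := by gcongr
      _ = lam ^ 11 / Q ^ 11 := by rw [h2, div_pow]
      _ ≤ lam / Q ^ 11 := by
        gcongr
        exact pow_le_of_le_one hlam0.le hlam1 (by norm_num)
  have hcontr : k * rpdgAlpha m C ^ k ≤ 32 * Q * (lam / Q ^ 11) :=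
    calc k * rpdgAlpha m C ^ k ≤ 2 * N * Real.exp (-(k / (2 * N))) := one_sub_inv_pow_mul_le hN1 k
      _ ≤ 2 * (8 * (2 * Q)) * (lam / Q ^ 11) := by gcongr; linarith
      _ = _ := by ring
  have hα := (rpdgAlpha_mem hm C).1
  calc (1 + 2 * r) * (1 + 4 * r) * (k * rpdgAlpha m C ^ k)
      ≤ (2 * Q) * (4 * Q) * (32 * Q * (lam / Q ^ 11)) := by gcongr <;> linarith
    _ = lam * (2 ^ 8 / Q ^ 8) := by field_simp; norm_num
    _ ≤ lam * 1 := by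
        gcongr
        rw [div_le_one (by positivity)]
        gcongr
    _ = lam := mul_one _

/-- If `m ε ≤ 1` then `m ≤ √(m/ε)`, so the additive `m` costs a factor 2. With `q = m/(lam ε) ≥ 2`
the argument of the logarithm is at most `2q ≤ q²`, another factor 2. -/
theorem iterations_small_accuracy {m : ℕ} (hm : 1 ≤ m) {ε lam : ℝ} (hε : 0 < ε)
    (hmε : m * ε ≤ 1) (hε2 : ε ≤ 1 / 2) (hlam0 : 0 < lam) (hlam1 : lam ≤ 1) :
    (m + √(m / ε)) * Real.log (m * (2 + 1 / ε) / lam) ≤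
      4 * (√(m / ε) * Real.log (m / (lam * ε))) := by
  have hm' : (1 : ℝ) ≤ m := by exact_mod_cast hm
  have h1 : (m : ℝ) ≤ √(m / ε) := by
    apply Real.le_sqrt_of_sq_le
    rw [le_div_iff₀ hε]
    nlinarith
  have hq : 2 ≤ m / (lam * ε) := by
    rw [le_div_iff₀ (by positivity)]
    nlinarith
  have h2 : m * (2 + 1 / ε) / lam ≤ (m / (lam * ε)) ^ 2 := by
    have h3 : 2 + 1 / ε ≤ 2 / ε := by
      have : 2 ≤ 1 / ε := by rw [le_div_iff₀ hε]; linarith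
      have e : 2 / ε = 1 / ε + 1 / ε := by ring
      linarith
    calc m * (2 + 1 / ε) / lam ≤ m * (2 / ε) / lam := by gcongr
      _ = 2 * (m / (lam * ε)) := by field_simp
      _ ≤ (m / (lam * ε)) ^ 2 := by nlinarith
  have h4 : Real.log (m * (2 + 1 / ε) / lam) ≤ 2 * Real.log (m / (lam * ε)) := by
    have h5 := Real.log_le_log (by positivity) h2
    rwa [Real.log_pow] at h5
  have h6 : 0 ≤ Real.log (m / (lam * ε)) := Real.log_nonneg (by linarith)
  have h7 : 0 ≤ Real.log (m * (2 + 1 / ε) / lam) := Real.log_nonneg (by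
    rw [le_div_iff₀ hlam0]
    nlinarith [one_div_pos.2 hε])
  calc (m + √(m / ε)) * Real.log (m * (2 + 1 / ε) / lam)
      ≤ (√(m / ε) + √(m / ε)) * (2 * Real.log (m / (lam * ε))) := by gcongr
    _ = _ := by ring

theorem proposition4p4 :
    ∃ c : ℝ, 0 < c ∧
      ∀ (n m : ℕ) (f : Fin m → Eucl n → ℝ) (Lc : Fin m → ℝ) (x0 : Eucl n) (L ε δ C : ℝ),
        (∀ j, Differentiable ℝ (f j)) →
        (∀ j, ConvexOn ℝ Set.univ (f j)) →
        (∀ j, 0 ≤ Lc j) →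
        (∀ j x y, ‖gradient (f j) x - gradient (f j) y‖ ≤ Lc j * ‖x - y‖) →
        (minimizers fun x => ∑ j, f j x).Nonempty →
        L = ∑ j, Lc j →
        0 < L →
        0 < ε →
        δ = L * ε / 2 →
        (C = 8 * L / δ ∨ C = 8 * (L + δ) / δ) →
        ∀ (Ω : Type*) [MeasurableSpace Ω] (ν : Measure Ω) [IsProbabilityMeasure ν]
          (i : ℕ → Ω → Fin m),
          (∀ t, Measurable (i t)) →
          iIndepFun i ν →
          (∀ t j, ν.real {w | i t w = j} = (nonuniformParams Lc δ C).p j) →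
          -- the bounds valid for all `m` and `ε`
          (∀ k : ℕ, c * ((m + √(m / ε)) * Real.log (m * (2 + 1 / ε))) ≤ k →
            Integrable (fun w => rpdgRelAccuracy f Lc x0 δ C (fun t => i t w) k) ν ∧
            ∫ w, rpdgRelAccuracy f Lc x0 δ C (fun t => i t w) k ∂ν ≤ ε) ∧
          (∀ lam : ℝ, 0 < lam → lam < 1 →
            ∀ k : ℕ, c * ((m + √(m / ε)) * Real.log (m * (2 + 1 / ε) / lam)) ≤ k →
              ν.real {w | ε < rpdgRelAccuracy f Lc x0 δ C (fun t => i t w) k} ≤ lam) ∧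
          -- the bounds for small `ε`
          (m * ε ≤ 1 → ε ≤ 1 / 2 →
            (∀ k : ℕ, c * (√(m / ε) * Real.log (m / ε)) ≤ k →
              Integrable (fun w => rpdgRelAccuracy f Lc x0 δ C (fun t => i t w) k) ν ∧
              ∫ w, rpdgRelAccuracy f Lc x0 δ C (fun t => i t w) k ∂ν ≤ ε) ∧
            (∀ lam : ℝ, 0 < lam → lam < 1 →
              ∀ k : ℕ, c * (√(m / ε) * Real.log (m / (lam * ε))) ≤ k →
                ν.real {w | ε < rpdgRelAccuracy f Lc x0 δ C (fun t => i t w) k} ≤ lam)) := by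
  -- `704 = 4 · 176`: the general iteration count times the loss in `iterations_small_accuracy`.
  refine ⟨704, by norm_num, ?_⟩
  intro n m f Lc x0 L ε δ C hf hc hL0 hL hmin hLdef hLpos hε hδ hC Ω _ ν _ i hi hind hip
  subst hLdef
  have hm : 1 ≤ m := by
    rcases Nat.eq_zero_or_pos m with rfl | h
    · simp at hLpos
    · exact h
  have hm' : (1 : ℝ) ≤ m := by exact_mod_cast hm
  have hδ0 : 0 < δ := by rw [hδ]; positivity
  have hLδ : 8 * (∑ j, Lc j) / δ = 16 / ε := by rw [hδ]; field_simp; norm_num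
  have hCpos : 0 < C := by rcases hC with rfl | rfl <;> positivity
  have hCle : C ≤ 16 / ε + 8 := by
    rcases hC with rfl | rfl
    · rw [hLδ]; linarith
    · rw [mul_add, add_div, hLδ, mul_div_assoc, div_self hδ0.ne', mul_one]
  have hδC : 8 * (∑ j, Lc j) ≤ δ * C := by
    rcases hC with rfl | rfl
    · rw [mul_div_cancel₀ _ hδ0.ne']
    · rw [mul_div_cancel₀ _ hδ0.ne']; linarith
  -- The value `lam = 1` is admitted because it yields the expectation bounds.
  have main : ∀ lam : ℝ, 0 < lam → lam ≤ 1 → ∀ k : ℕ,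
      176 * ((m + √(m / ε)) * Real.log (m * (2 + 1 / ε) / lam)) ≤ k →
      (Integrable (fun w => rpdgRelAccuracy f Lc x0 δ C (fun t => i t w) k) ν ∧
        ∫ w, rpdgRelAccuracy f Lc x0 δ C (fun t => i t w) k ∂ν ≤ ε) ∧
      ν.real {w | ε < rpdgRelAccuracy f Lc x0 δ C (fun t => i t w) k} ≤ lam := by
    intro lam h0 h1 k hk
    obtain ⟨hk1, hkα⟩ := contraction_le_of_iterations hm hε hCpos hCle h0 h1 hk
    exact rpdgRelAccuracy_bounds hf hc hL0 hL hmin hLpos hm hε hδ hCpos hδC hi hind hip hk1 h0 h1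
      hkα
  have hnonneg : ∀ lam : ℝ, 0 < lam → lam ≤ 1 →
      0 ≤ (m + √(m / ε)) * Real.log (m * (2 + 1 / ε) / lam) := by
    intro lam h0 h1
    refine mul_nonneg (by positivity) (Real.log_nonneg ?_)
    rw [le_div_iff₀ h0]
    nlinarith [one_div_pos.2 hε]
  refine ⟨fun k hk => ?_, fun lam h0 h1 k hk => ?_, fun hmε hε2 => ⟨fun k hk => ?_,
    fun lam h0 h1 k hk => ?_⟩⟩
  · refine (main 1 one_pos le_rfl k ?_).1
    have := hnonneg 1 one_pos le_rfl
    rw [div_one] at this ⊢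
    linarith
  · refine (main lam h0 h1.le k ?_).2
    linarith [hnonneg lam h0 h1.le]
  · refine (main 1 one_pos le_rfl k ?_).1
    have := iterations_small_accuracy hm hε hmε hε2 one_pos le_rfl
    rw [one_mul] at this
    linarith
  · refine (main lam h0 h1.le k ?_).2
    linarith [iterations_small_accuracy hm hε hmε hε2 h0 h1.le]
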